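/- Let $d\ge 1$. For $k=1,\dots,d$ let $-\infty\le a_k<b_k\le+\infty$, let $\mu_k$ be a probability measure on $(a_k,b_k)$ whose density is continuous and piecewise $C^1$ on $[a_k,b_k]$ (infinite end points excluded) and positive on $(a_k,b_k)$, and let $w_k$ be a function that is continuous on $[a_k,b_k]$ and piecewise $C^1$ and positive on $(a_k,b_k)$. Let $H^1(\mu_k,w_k)$ be the space of $f\in L^2(\mu_k)$ with a weak derivative $f'$ on $(a_k,b_k)$ such that $\int w_k (f')^2\,d\mu_k<\infty$. Assume that for each $k$ the pair $(\mu_k,w_k)$ has a Poincaré basis $(\psi_{k,j})_{j\in\mathbb N}$ with eigenvalues $0=\lambda_{k,0}<\lambda_{k,1}<\cdots$, that is, an orthonormal basis of $L^2(\mu_k)$ with $\psi_{k,j}\in H^1(\mu_k,w_k)$ and $$\int \psi_{k,j}'\,g'\,w_k\,d\mu_k=\lambda_{k,j}\int\psi_{k,j}\,g\,d\mu_k\qquad\text{for all } g\in H^1(\mu_k,w_k).$$ Let $X=(X_1,\dots,X_d)$ have law $\mu=\mu_1\otimes\cdots\otimes\mu_d$, let $\mathcal M\in L^2(\mu)$,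 and let $i\in\{1,\dots,d\}$ be such that $\partial\mathcal M/\partial x_i$ exists at every point of $\prod_k(a_k,b_k)$. For $\alpha\in\mathbb N^d$ put $\psi_\alpha(x)=\prod_k\psi_{k,\alpha_k}(x_k)$, and let $c_\alpha=\int\mathcal M\,\psi_\alpha\,d\mu$ be the coefficients of the Poincaré chaos expansion $\mathcal M=\sum_\alpha c_\alpha\psi_\alpha$. Then the weighted derivative-based sensitivity measure $\nu_i=\mathbb E\big[w_i(X_i)\,(\partial\mathcal M/\partial x_i(X))^2\big]\in[0,\infty]$ satisfies $$\nu_i=\sum_{\alpha\in\mathbb N^d,\ \alpha_i\ge1}\lambda_{i,\alpha_i}\,c_\alpha^2\qquad\text{(in }[0,\infty]\text{)}.$$ Moreover, $1/\lambda_{i,1}$ is the Poincaré constant $C_P(\mu_i,w_i)$, that is, the smallest $C$ with $\int f^2\,d\mu_i\le C\int w_i (f')^2\,d\mu_i$ for all $f\in H^1(\mu_i,w_i)$ with $\int f\,d\mu_i=0$. Finally, $\mathcal M(X)$ has a Sobol'–Hoeffding decomposition, that is, $\mathcal M(X)=\sum_{I\subseteq\{1,\dots,d\}}\mathcal M_I(X_I)$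 almost surely with square-integrable terms such that $\mathbb E[\mathcal M_I(X_I)\mid X_J]=0$ for all $J\subsetneq I$; and if $\operatorname{Var}(\mathcal M(X))>0$, then for this decomposition the total Sobol' index $S_i^{\mathrm{tot}}=\sum_{I\ni i}\operatorname{Var}(\mathcal M_I(X_I))/\operatorname{Var}(\mathcal M(X))$ satisfies $$S_i^{\mathrm{tot}}\le C_P(\mu_i,w_i)\,\frac{\nu_i}{\operatorname{Var}(\mathcal M(X))},\qquad C_P(\mu_i,w_i)=\frac1{\lambda_{i,1}}.$$ -/

import Mathlib

open MeasureTheory ProbabilityTheory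
open scoped ENNReal ContDiff

noncomputable section

/-- The open interval `(a, b)` of the real line, with possibly infinite end points. -/
def openInterval (a b : EReal) : Set ℝ := {x : ℝ | a < (x : EReal) ∧ (x : EReal) < b}

/-- The real points of `[a, b]`; an infinite end point is left out. -/
def closedInterval (a b : EReal) : Set ℝ := {x : ℝ | a ≤ (x : EReal) ∧ (x : EReal) ≤ b}

/-- `f` is piecewise `C¹` on the interval `J`: there is a set `F` of break points, finite in every
compact subinterval of `J`, such that `f` is `C¹`, up to the (one-sided) end points, on every
compact subinterval of `J` that has no break point in its interior. -/
def PiecewiseC1On (f : ℝ → ℝ) (J : Set ℝ) : Prop :=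
  ∃ F : Set ℝ,
    (∀ u v : ℝ, Set.Icc u v ⊆ J → (F ∩ Set.Icc u v).Finite) ∧
    ∀ u v : ℝ, u < v → Set.Icc u v ⊆ J → Disjoint (Set.Ioo u v) F →
      ContDiffOn ℝ 1 f (Set.Icc u v)

/-- The class `𝒫(a, b)` of probability measures on `(a, b)` with a density that is continuous and
piecewise `C¹` on `[a, b]` and positive on `(a, b)`. -/
def densityClass (a b : EReal) : Set (Measure ℝ) :=
  {μ | IsProbabilityMeasure μ ∧
    ∃ ρ : ℝ → ℝ, ContinuousOn ρ (closedInterval a b) ∧ PiecewiseC1On ρ (closedInterval a b) ∧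
      (∀ x ∈ openInterval a b, 0 < ρ x) ∧
      μ = (volume.restrict (openInterval a b)).withDensity fun x => ENNReal.ofReal (ρ x)}

/-- The class `𝒲(a, b)` of weights: continuous on `[a, b]`, piecewise `C¹` and positive on
`(a, b)`. -/
def weightClass (a b : EReal) : Set (ℝ → ℝ) :=
  {w | ContinuousOn w (closedInterval a b) ∧ PiecewiseC1On w (openInterval a b) ∧
    ∀ x ∈ openInterval a b, 0 < w x}

/-- `f'` is a weak derivative of `f` on `(a, b)`. -/
def IsWeakDeriv (a b : EReal) (f f' : ℝ → ℝ) : Prop :=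
  LocallyIntegrableOn f (openInterval a b) ∧ LocallyIntegrableOn f' (openInterval a b) ∧
    ∀ η : ℝ → ℝ, ContDiff ℝ ∞ η → HasCompactSupport η → tsupport η ⊆ openInterval a b →
      ∫ x in openInterval a b, f x * deriv η x = -∫ x in openInterval a b, f' x * η x

/-- `f` belongs to the weighted Sobolev space `H¹(μ, w)` on `(a, b)`, with weak derivative `f'`:
`f ∈ L²(μ)` and `f' ∈ L²(μ, w)`. -/
def MemH1 (a b : EReal) (μ : Measure ℝ) (w f f' : ℝ → ℝ) : Prop :=
  IsWeakDeriv a b f f' ∧ MemLp f 2 μ ∧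
    MemLp f' 2 (μ.withDensity fun x => ENNReal.ofReal (w x))

/-- `μ` satisfies the Poincaré inequality with weight `w` and constant `C`. -/
def PoincareInequality (a b : EReal) (μ : Measure ℝ) (w : ℝ → ℝ) (C : ℝ) : Prop :=
  ∀ f f' : ℝ → ℝ, MemH1 a b μ w f f' → ∫ x, f x ∂μ = 0 →
    ∫ x, f x ^ 2 ∂μ ≤ C * ∫ x, w x * f' x ^ 2 ∂μ

/-- `C` is the Poincaré constant `C_P(μ, w)`, the smallest constant in the inequality. -/
def IsPoincareConstant (a b : EReal) (μ : Measure ℝ) (w : ℝ → ℝ) (C : ℝ) : Prop :=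
  IsLeast {C : ℝ | PoincareInequality a b μ w C} C

/-- `f ∈ H¹(μ, w)` solves the spectral problem `⟨f', g'⟩_w = lam ⟨f, g⟩` for all `g ∈ H¹(μ, w)`. -/
def SolvesSpectralProblem (a b : EReal) (μ : Measure ℝ) (w : ℝ → ℝ) (lam : ℝ) (f : ℝ → ℝ) :
    Prop :=
  ∃ f' : ℝ → ℝ, MemH1 a b μ w f f' ∧
    ∀ g g' : ℝ → ℝ, MemH1 a b μ w g g' →
      ∫ x, f' x * g' x * w x ∂μ = lam * ∫ x, f x * g x ∂μ

/-- `φ` is the Poincaré basis of `(μ, w)`, with eigenvalues `0 = lam 0 < lam 1 < ⋯`: the `φ j` are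
eigenfunctions that form an orthonormal basis of `L²(μ)`. -/
structure IsPoincareBasis (a b : EReal) (μ : Measure ℝ) (w : ℝ → ℝ) (φ : ℕ → ℝ → ℝ)
    (lam : ℕ → ℝ) : Prop where
  lam_zero : lam 0 = 0
  lam_strictMono : StrictMono lam
  eigen : ∀ j, SolvesSpectralProblem a b μ w (lam j) (φ j)
  basis : ∃ e : HilbertBasis ℕ ℝ (Lp ℝ 2 μ), ∀ j, ⇑(e j) =ᵐ[μ] φ j

/-- The tensorized basis function `ψ_α(x) = ∏ₖ ψ_{k, αₖ}(xₖ)`. -/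
def tensorBasis {d : ℕ} (ψ : Fin d → ℕ → ℝ → ℝ) (α : Fin d → ℕ) (x : Fin d → ℝ) : ℝ :=
  ∏ k, ψ k (α k) (x k)

/-- The coefficient `c_α = ⟨M, ψ_α⟩` of the chaos expansion of `M`. -/
def chaosCoeff {d : ℕ} (μ : Fin d → Measure ℝ) (ψ : Fin d → ℕ → ℝ → ℝ) (M : (Fin d → ℝ) → ℝ)
    (α : Fin d → ℕ) : ℝ :=
  ∫ x, M x * tensorBasis ψ α x ∂Measure.pi μ

/-- The partial derivative `∂M/∂xᵢ`. -/
def partialDeriv {d : ℕ} (i : Fin d) (M : (Fin d → ℝ) → ℝ) (x : Fin d → ℝ) : ℝ :=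
  deriv (fun t => M (Function.update x i t)) (x i)

/-- The weighted derivative-based sensitivity measure `𝔼[wᵢ(Xᵢ) (∂M/∂xᵢ(X))²]`, an element of
`[0, ∞]`, where `X` has independent coordinates with laws `μ k`. -/
def dgsm {d : ℕ} (μ : Fin d → Measure ℝ) (wi : ℝ → ℝ) (i : Fin d) (M : (Fin d → ℝ) → ℝ) : ℝ≥0∞ :=
  ∫⁻ x, ENNReal.ofReal (wi (x i) * partialDeriv i M x ^ 2) ∂Measure.pi μ

/-- `N` is the Sobol'-Hoeffding decomposition of `M`: `M(X) = ∑_I N_I(X_I)`, where the terms are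
square integrable and `𝔼[N_I(X_I) | X_J] = 0` for all strict subsets `J` of `I`. -/
structure IsSobolHoeffding {d : ℕ} (P : Measure (Fin d → ℝ)) (M : (Fin d → ℝ) → ℝ)
    (N : (I : Finset (Fin d)) → (I → ℝ) → ℝ) : Prop where
  memLp : ∀ I, MemLp (fun x => N I (I.restrict x)) 2 P
  sum_eq : M =ᵐ[P] fun x => ∑ I, N I (I.restrict x)
  condExp_eq_zero : ∀ I J : Finset (Fin d), J ⊂ I →
    P[fun x => N I (I.restrict x) |
      MeasurableSpace.comap (fun x : Fin d → ℝ => J.restrict x) inferInstance] =ᵐ[P] 0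

/-- The total Sobol' index `Sᵢ^tot = ∑_{I ∋ i} Var N_I(X_I) / Var M(X)`, computed from the
Sobol'-Hoeffding decomposition `N` of `M`. -/
def totalSobolIndex {d : ℕ} (P : Measure (Fin d → ℝ)) (M : (Fin d → ℝ) → ℝ)
    (N : (I : Finset (Fin d)) → (I → ℝ) → ℝ) (i : Fin d) : ℝ :=
  (∑ I with i ∈ I, variance (fun x => N I (I.restrict x)) P) / variance M P

end

/-!
A function that is differentiable everywhere on `(a, b)` and has a weak derivative there has almost
everywhere the latter as its classical derivative: by the lemma of du Bois-Reymond it differs from a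
primitive of its weak derivative by a constant. Conversely, `f ∈ L²(μ)` whose classical derivative
is in `L²(μ, w)` belongs to `H¹(μ, w)`.

By the spectral equation the derivatives of the `φ j` are orthogonal in `L²(μ, w)`, with squared
norms `lam j`, and `f' ∈ L²(μ, w)` has the coefficients of `f` along them. Bessel's inequality
bounds `∑ lam j * c j ^ 2` by `∫ w f'²`. If the sum is finite, the series of derivatives converges
in `L²(μ, w)`, and since the weak derivative is a closed operator its sum is the derivative of `f`.
Hence `∫ w f'² = ∑ lam j * c j ^ 2` in `[0, ∞]`, also where `f` is not in `H¹(μ, w)`. For `f` of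
mean zero the term `j = 0` is absent, which gives the Poincaré inequality with constant `1 / lam 1`.

This applies to almost every slice of `M` in the `i`-th direction; Parseval's identity in the other
coordinates and Tonelli's theorem give the expansion of `ν_i`. Averages over sets of coordinates
commute, `𝔼[𝔼[M | X_J] | X_K] = 𝔼[M | X_(J ∩ K)]`, so that inclusion-exclusion produces the
Sobol'-Hoeffding terms. These are orthogonal, and those with `i ∈ I` add up to `M - 𝔼[M | X_(≠ i)]`,
whose variance is the mean of the variances of the slices.
-/

noncomputable section

open Set Filter Topology Function

lemma exists_subset_Ioo_of_isCompact {U K : Set ℝ} [U.OrdConnected] (hU : IsOpen U)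
    (hK : IsCompact K) (hne : K.Nonempty) (hKU : K ⊆ U) :
    ∃ p q, K ⊆ Ioo p q ∧ Icc p q ⊆ U := by
  obtain ⟨p, hp, hpU⟩ := mem_nhdsLE_iff_exists_Icc_subset.1
    (mem_nhdsWithin_of_mem_nhds (hU.mem_nhds (hKU (hK.sInf_mem hne))))
  obtain ⟨q, hq, hqU⟩ := mem_nhdsGE_iff_exists_Icc_subset.1
    (mem_nhdsWithin_of_mem_nhds (hU.mem_nhds (hKU (hK.sSup_mem hne))))
  refine ⟨p, q, fun x hx => ⟨hp.trans_le (csInf_le hK.bddBelow hx),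
    (le_csSup hK.bddAbove hx).trans_lt hq⟩, ?_⟩
  exact OrdConnected.out' (hpU (left_mem_Icc.2 hp.le)) (hqU (right_mem_Icc.2 hq.le))

/-- `η` is a test function on `U`: smooth with compact support inside `U`. -/
structure IsTestFunction (U : Set ℝ) (η : ℝ → ℝ) : Prop where
  contDiff : ContDiff ℝ ∞ η
  hasCompactSupport : HasCompactSupport η
  tsupport_subset : tsupport η ⊆ U

namespace IsTestFunction

variable {U : Set ℝ} {η θ : ℝ → ℝ}

lemma deriv (hη : IsTestFunction U η) : IsTestFunction U (deriv η) where
  contDiff := (contDiff_infty_iff_deriv.1 hη.contDiff).2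
  hasCompactSupport := hη.hasCompactSupport.deriv
  tsupport_subset := tsupport_deriv_subset.trans hη.tsupport_subset

lemma integrable (hη : IsTestFunction U η) : Integrable η :=
  hη.contDiff.continuous.integrable_of_hasCompactSupport hη.hasCompactSupport

lemma integrable_mul {h : ℝ → ℝ} (hη : IsTestFunction U η) (hh : LocallyIntegrableOn h U) :
    Integrable fun x => h x * η x := by
  refine (integrableOn_iff_integrable_of_support_subset
    ((support_mul_subset_right _ _).trans (subset_tsupport η))).1 ?_
  exact (hh.integrableOn_compact_subset hη.tsupport_subset hη.hasCompactSupport).mul_continuousOn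
    hη.contDiff.continuous.continuousOn hη.hasCompactSupport

lemma setIntegral_mul (hη : IsTestFunction U η) (h : ℝ → ℝ) :
    ∫ x in U, h x * η x = ∫ x, h x * η x :=
  setIntegral_eq_integral_of_forall_compl_eq_zero fun x hx => by
    rw [image_eq_zero_of_notMem_tsupport fun hx' => hx (hη.tsupport_subset hx'), mul_zero]

lemma mul_left (hη : IsTestFunction U η) (hθ : ContDiff ℝ ∞ θ) :
    IsTestFunction U fun x => θ x * η x where
  contDiff := hθ.mul hη.contDiff
  hasCompactSupport := hη.hasCompactSupport.mul_left
  tsupport_subset :=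
    (closure_mono (support_mul_subset_right _ _)).trans hη.tsupport_subset

lemma sub (hη : IsTestFunction U η) (hθ : IsTestFunction U θ) :
    IsTestFunction U fun x => η x - θ x where
  contDiff := hη.contDiff.sub hθ.contDiff
  hasCompactSupport := hη.hasCompactSupport.sub hθ.hasCompactSupport
  tsupport_subset :=
    (tsupport_sub _ _).trans (union_subset hη.tsupport_subset hθ.tsupport_subset)

lemma exists_integral_eq_one (hU : IsOpen U) (hne : U.Nonempty) :
    ∃ η, IsTestFunction U η ∧ ∫ x, η x = 1 := by
  obtain ⟨p, hp⟩ := hne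
  obtain ⟨ε, hε, hball⟩ := Metric.nhds_basis_closedBall.mem_iff.1 (hU.mem_nhds hp)
  let φ : ContDiffBump p := ⟨ε / 2, ε, half_pos hε, half_lt_self hε⟩
  refine ⟨φ.normed volume, ⟨φ.contDiff_normed, φ.hasCompactSupport_normed, ?_⟩,
    φ.integral_normed⟩
  rwa [φ.tsupport_normed_eq]

lemma exists_primitive [U.OrdConnected] (hU : IsOpen U) (hη : IsTestFunction U η)
    (h0 : ∫ x, η x = 0) : ∃ Z, IsTestFunction U Z ∧ _root_.deriv Z = η := by
  rcases (tsupport η).eq_empty_or_nonempty with hempty | hne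
  · obtain rfl := tsupport_eq_empty_iff.1 hempty
    exact ⟨0, hη, by ext; simp⟩
  obtain ⟨p, q, hpq, hsub⟩ := exists_subset_Ioo_of_isCompact hU hη.hasCompactSupport hne
    hη.tsupport_subset
  set Z : ℝ → ℝ := fun x => ∫ t in p..x, η t
  have hderiv : ∀ x, HasDerivAt Z (η x) x := fun x =>
    hη.contDiff.continuous.integral_hasStrictDerivAt p x |>.hasDerivAt
  have hderiv' : _root_.deriv Z = η := funext fun x => (hderiv x).deriv
  have hzero : support Z ⊆ Icc p q := by
    intro x hx
    by_contra hxpq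
    refine hx ?_
    rcases le_total p x with hpx | hxp
    · have hqx : q < x := not_le.1 fun h => hxpq ⟨hpx, h⟩
      rw [← h0]
      exact intervalIntegral.integral_eq_integral_of_support_subset fun y hy =>
        ⟨(hpq (subset_tsupport η hy)).1, (hpq (subset_tsupport η hy)).2.le.trans hqx.le⟩
    · refine intervalIntegral.integral_zero_ae (ae_of_all _ fun t ht => ?_)
      rw [uIoc_of_ge hxp] at ht
      exact image_eq_zero_of_notMem_tsupport fun h => (hpq h).1.not_ge ht.2
  refine ⟨Z, ⟨?_, HasCompactSupport.of_support_subset_isCompact isCompact_Icc hzero,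
    (closure_minimal hzero isClosed_Icc).trans hsub⟩, hderiv'⟩
  exact contDiff_infty_iff_deriv.2
    ⟨fun x => (hderiv x).differentiableAt, hderiv'.symm ▸ hη.contDiff⟩

end IsTestFunction

/-- The lemma of du Bois-Reymond: a test function `η` differs from a multiple of a fixed one by a
function of integral zero, which is the derivative of a test function. -/
lemma exists_ae_eq_const_of_integral_mul_deriv_eq_zero {U : Set ℝ} [U.OrdConnected]
    (hU : IsOpen U) {h : ℝ → ℝ} (hh : LocallyIntegrableOn h U)
    (H : ∀ η, IsTestFunction U η → ∫ x, h x * deriv η x = 0) :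
    ∃ c, ∀ᵐ x, x ∈ U → h x = c := by
  rcases U.eq_empty_or_nonempty with rfl | hne
  · exact ⟨0, by simp⟩
  obtain ⟨η₀, hη₀, hη₀_one⟩ := IsTestFunction.exists_integral_eq_one hU hne
  set c := ∫ x, h x * η₀ x
  have hzero : ∀ᵐ x, x ∈ U → h x - c = 0 := by
    refine hU.ae_eq_zero_of_integral_contDiff_smul_eq_zero
      (hh.sub (locallyIntegrableOn_const c)) fun η hη hηc hηU => ?_
    have hηt : IsTestFunction U η := ⟨hη, hηc, hηU⟩
    have hmean : ∫ x, (η x - (∫ y, η y) * η₀ x) = 0 := by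
      rw [integral_sub hηt.integrable (hη₀.integrable.const_mul _), integral_const_mul, hη₀_one,
        mul_one, sub_self]
    obtain ⟨Z, hZ, hZη⟩ := (hηt.sub (hη₀.mul_left contDiff_const)).exists_primitive hU hmean
    calc ∫ x, η x • (h x - c)
        = (∫ x, h x * η x) - c * ∫ x, η x := by
          rw [← integral_const_mul, ← integral_sub (hηt.integrable_mul hh)
            (hηt.integrable.const_mul c)]
          congr with x
          rw [smul_eq_mul]
          ring
      _ = ∫ x, h x * deriv Z x := by
          rw [hZη, mul_comm c, ← integral_const_mul, ← integral_sub (hηt.integrable_mul hh)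
            ((hη₀.integrable_mul hh).const_mul _)]
          congr with x
          ring
      _ = 0 := H Z hZ
  exact ⟨c, hzero.mono fun x hx hxU => sub_eq_zero.1 (hx hxU)⟩

section Primitive

variable {U : Set ℝ} [U.OrdConnected] {g : ℝ → ℝ} {p : ℝ}

lemma intervalIntegrable_of_locallyIntegrableOn (hg : LocallyIntegrableOn g U) {r s : ℝ}
    (hr : r ∈ U) (hs : s ∈ U) : IntervalIntegrable g volume r s :=
  intervalIntegrable_iff.2 <| (hg.integrableOn_compact_subset
    (OrdConnected.uIcc_subset ‹_› hr hs) isCompact_uIcc).mono_set uIoc_subset_uIcc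

lemma ae_hasDerivAt_primitive (hg : LocallyIntegrableOn g U) (hp : p ∈ U) :
    ∀ᵐ x, x ∈ U → HasDerivAt (fun x => ∫ t in p..x, g t) (g x) x := by
  refine ae_of_mem_of_ae_of_mem_inter_Ioo fun r s hr hs _ => ?_
  have hg' := intervalIntegrable_of_locallyIntegrableOn hg
    (inf_ind r p hr hp : r ⊓ p ∈ U) (sup_ind s p hs hp : s ⊔ p ∈ U)
  have hle : r ⊓ p ≤ s ⊔ p := inf_le_right.trans le_sup_right
  filter_upwards [hg'.ae_hasDerivAt_integral] with x hx hxrs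
  rw [uIcc_of_le hle] at hx
  exact hx ⟨inf_le_left.trans hxrs.2.1.le, hxrs.2.2.le.trans le_sup_left⟩ p
    ⟨inf_le_right, le_sup_right⟩

lemma continuousOn_primitive_of_locallyIntegrableOn (hU : IsOpen U)
    (hg : LocallyIntegrableOn g U) (hp : p ∈ U) :
    ContinuousOn (fun x => ∫ t in p..x, g t) U := by
  intro x hx
  obtain ⟨r, s, hmem, hsub⟩ := exists_subset_Ioo_of_isCompact hU (isCompact_singleton.insert p)
    (insert_nonempty _ _) (insert_subset hp (singleton_subset_iff.2 hx))
  obtain ⟨hp', hx'⟩ : p ∈ Ioo r s ∧ x ∈ Ioo r s := by simpa [insert_subset_iff] using hmem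
  have hrs : r ≤ s := (hp'.1.trans hp'.2).le
  have hg' := intervalIntegrable_of_locallyIntegrableOn hg (hsub (left_mem_Icc.2 hrs))
    (hsub (right_mem_Icc.2 hrs))
  have hac := hg'.absolutelyContinuousOnInterval_intervalIntegral (c := p)
    (uIcc_of_le hrs ▸ Ioo_subset_Icc_self hp')
  have hcont := hac.continuousOn
  rw [uIcc_of_le hrs] at hcont
  exact (hcont.continuousAt (Icc_mem_nhds hx'.1 hx'.2)).continuousWithinAt

lemma integral_primitive_mul_deriv (hU : IsOpen U) (hg : LocallyIntegrableOn g U) (hp : p ∈ U)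
    {η : ℝ → ℝ} (hη : IsTestFunction U η) :
    ∫ x, (∫ t in p..x, g t) * deriv η x = -∫ x, g x * η x := by
  obtain ⟨r, s, hmem, hsub⟩ := exists_subset_Ioo_of_isCompact hU
    (hη.hasCompactSupport.isCompact.insert p) (insert_nonempty _ _)
    (insert_subset hp hη.tsupport_subset)
  obtain ⟨hp', hηrs⟩ := insert_subset_iff.1 hmem
  have hrs : r ≤ s := (hp'.1.trans hp'.2).le
  have hr := hsub (left_mem_Icc.2 hrs)
  have hs := hsub (right_mem_Icc.2 hrs)
  have hac := (intervalIntegrable_of_locallyIntegrableOn hg hr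
    hs).absolutelyContinuousOnInterval_intervalIntegral (c := p)
    (uIcc_of_le hrs ▸ Ioo_subset_Icc_self hp')
  have hηac : AbsolutelyContinuousOnInterval η r s :=
    (hη.contDiff.of_le (by exact_mod_cast le_top)).contDiffOn.absolutelyContinuousOnInterval
  have hηzero : ∀ x ∉ Ioo r s, η x = 0 := fun x hx =>
    image_eq_zero_of_notMem_tsupport fun h => hx (hηrs h)
  have hext : ∀ k θ : ℝ → ℝ, support θ ⊆ tsupport η →
      ∫ x, k x * θ x = ∫ x in r..s, k x * θ x := fun k θ hθ =>
    (intervalIntegral.integral_eq_integral_of_support_subset <|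
      (support_mul_subset_right _ _).trans <| hθ.trans <| hηrs.trans Ioo_subset_Ioc_self).symm
  have hparts := hac.integral_mul_deriv_eq_deriv_mul hηac
  rw [hηzero r (by simp), hηzero s (by simp), mul_zero, mul_zero, sub_zero, zero_sub] at hparts
  rw [hext _ _ support_deriv_subset, hext _ _ (subset_tsupport η), hparts]
  congr 1
  refine intervalIntegral.integral_congr_ae ?_
  filter_upwards [ae_hasDerivAt_primitive hg hp] with x hx hxrs
  rw [(hx (OrdConnected.uIcc_subset ‹_› hr hs (uIoc_subset_uIcc hxrs))).deriv]

end Primitive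

lemma isOpen_openInterval (a b : EReal) : IsOpen (openInterval a b) :=
  (isOpen_lt continuous_const continuous_coe_real_ereal).inter
    (isOpen_lt continuous_coe_real_ereal continuous_const)

instance (a b : EReal) : (openInterval a b).OrdConnected :=
  ⟨fun _ hx _ hy _ hz => ⟨hx.1.trans_le (EReal.coe_le_coe_iff.2 hz.1),
    (EReal.coe_le_coe_iff.2 hz.2).trans_lt hy.2⟩⟩

namespace IsWeakDeriv

variable {a b : EReal} {f f' g g' : ℝ → ℝ}

lemma integral_mul_deriv (h : IsWeakDeriv a b f f') {η : ℝ → ℝ}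
    (hη : IsTestFunction (openInterval a b) η) :
    ∫ x, f x * deriv η x = -∫ x, f' x * η x := by
  rw [← hη.deriv.setIntegral_mul, ← hη.setIntegral_mul]
  exact h.2.2 η hη.contDiff hη.hasCompactSupport hη.tsupport_subset

lemma ae_deriv_eq (h : IsWeakDeriv a b f f') (hf : ContinuousOn f (openInterval a b)) :
    ∀ᵐ x, x ∈ openInterval a b → deriv f x = f' x := by
  have hopen := isOpen_openInterval a b
  rcases (openInterval a b).eq_empty_or_nonempty with hempty | ⟨p, hp⟩
  · simp [hempty]
  set F : ℝ → ℝ := fun x => ∫ t in p..x, f' t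
  have hF := continuousOn_primitive_of_locallyIntegrableOn hopen h.2.1 hp
  have hF' := hF.locallyIntegrableOn (μ := volume) hopen.measurableSet
  obtain ⟨c, hc⟩ := exists_ae_eq_const_of_integral_mul_deriv_eq_zero hopen (h.1.sub hF')
    fun η hη => by
      simp only [Pi.sub_apply, sub_mul]
      rw [integral_sub (hη.deriv.integrable_mul h.1) (hη.deriv.integrable_mul hF'),
        h.integral_mul_deriv hη, integral_primitive_mul_deriv hopen h.2.1 hp hη, sub_self]
  have hconst : EqOn (f - F) (fun _ => c) (openInterval a b) :=
    Measure.eqOn_open_of_ae_eq ((ae_restrict_iff' hopen.measurableSet).2 hc) hopen (hf.sub hF)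
      continuousOn_const
  filter_upwards [ae_hasDerivAt_primitive h.2.1 hp] with x hx hxU
  have hfF : f =ᶠ[𝓝 x] fun y => F y + c := by
    filter_upwards [hopen.mem_nhds hxU] with y hy
    exact sub_eq_iff_eq_add'.1 (hconst hy)
  rw [hfF.deriv_eq, ((hx hxU).add_const c).deriv]

end IsWeakDeriv

section WithDensity

variable {Ω : Type*} [MeasurableSpace Ω] {m : Measure Ω} {ρ : Ω → ℝ}

lemma integral_withDensity_ofReal (hρ : AEMeasurable ρ m) (hρ0 : 0 ≤ᵐ[m] ρ) (f : Ω → ℝ) :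
    ∫ x, f x ∂m.withDensity (fun x => ENNReal.ofReal (ρ x)) = ∫ x, ρ x * f x ∂m := by
  rw [integral_withDensity_eq_integral_toReal_smul₀ hρ.ennreal_ofReal
    (ae_of_all _ fun _ => ENNReal.ofReal_lt_top)]
  refine integral_congr_ae (hρ0.mono fun x hx => ?_)
  simp only [ENNReal.toReal_ofReal hx, smul_eq_mul]

lemma integrable_withDensity_ofReal_iff (hρ : AEMeasurable ρ m) (hρ0 : 0 ≤ᵐ[m] ρ) {f : Ω → ℝ} :
    Integrable f (m.withDensity fun x => ENNReal.ofReal (ρ x)) ↔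
      Integrable (fun x => ρ x * f x) m := by
  rw [integrable_withDensity_iff_integrable_smul₀' hρ.ennreal_ofReal
    (ae_of_all _ fun _ => ENNReal.ofReal_lt_top)]
  refine integrable_congr (hρ0.mono fun x hx => ?_)
  simp only [ENNReal.toReal_ofReal hx, smul_eq_mul]

lemma inner_toLp_toLp {f g : Ω → ℝ} (hf : MemLp f 2 m) (hg : MemLp g 2 m) :
    inner ℝ (hf.toLp f) (hg.toLp g) = ∫ x, f x * g x ∂m := by
  rw [L2.inner_def]
  refine integral_congr_ae ?_
  filter_upwards [hf.coeFn_toLp, hg.coeFn_toLp] with x hfx hgx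
  simp [hfx, hgx, mul_comm]

end WithDensity

/-- `m` has a density `ρ > 0` on `U` with `ρ⁻¹` locally integrable. This is the condition of Kufner
and Opic under which `L²(m)` consists of distributions on `U`, so that weak derivatives make sense
and Sobolev spaces weighted by `m` are complete. -/
def IsKufnerOpic (U : Set ℝ) (m : Measure ℝ) : Prop :=
  ∃ ρ : ℝ → ℝ, AEMeasurable ρ (volume.restrict U) ∧ (∀ᵐ x ∂volume.restrict U, 0 < ρ x) ∧
    LocallyIntegrableOn (fun x => (ρ x)⁻¹) U ∧
    m = (volume.restrict U).withDensity fun x => ENNReal.ofReal (ρ x)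

namespace IsKufnerOpic

variable {U : Set ℝ} {m : Measure ℝ}

lemma of_continuousOn (hU : IsOpen U) {ρ : ℝ → ℝ} (hρ : ContinuousOn ρ U)
    (hpos : ∀ x ∈ U, 0 < ρ x) :
    IsKufnerOpic U ((volume.restrict U).withDensity fun x => ENNReal.ofReal (ρ x)) :=
  ⟨ρ, hρ.aemeasurable hU.measurableSet, (ae_restrict_mem hU.measurableSet).mono hpos,
    (hρ.inv₀ fun x hx => (hpos x hx).ne').locallyIntegrableOn hU.measurableSet, rfl⟩

lemma absolutelyContinuous (hm : IsKufnerOpic U m) : m ≪ volume.restrict U := by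
  obtain ⟨ρ, -, -, -, rfl⟩ := hm
  exact withDensity_absolutelyContinuous _ _

lemma restrict_absolutelyContinuous (hm : IsKufnerOpic U m) : volume.restrict U ≪ m := by
  obtain ⟨ρ, hρ, hpos, -, rfl⟩ := hm
  exact withDensity_absolutelyContinuous' hρ.ennreal_ofReal
    (hpos.mono fun x hx => (ENNReal.ofReal_pos.2 hx).ne')

lemma locallyIntegrableOn (hm : IsKufnerOpic U m) (hU : IsOpen U) {h : ℝ → ℝ}
    (hh : MemLp h 2 m) : LocallyIntegrableOn h U := by
  have hmeas : AEStronglyMeasurable h (volume.restrict U) :=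
    hh.1.mono_ac hm.restrict_absolutelyContinuous
  obtain ⟨ρ, hρ, hpos, hinv, rfl⟩ := hm
  have hsq : IntegrableOn (fun x => ρ x * h x ^ 2) U :=
    (integrable_withDensity_ofReal_iff hρ (hpos.mono fun x hx => hx.le)).1 hh.integrable_sq
  refine (locallyIntegrableOn_iff hU.isLocallyClosed).2 fun K hKU hK => ?_
  refine Integrable.mono' ((hsq.mono_set hKU).add (hinv.integrableOn_compact_subset hKU hK))
    (hmeas.mono_set hKU) (ae_restrict_of_ae_restrict_of_subset hKU ?_)
  filter_upwards [hpos] with x hx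
  have hmul : ρ x * (ρ x)⁻¹ = 1 := mul_inv_cancel₀ hx.ne'
  have hinv_nonneg : 0 ≤ (ρ x)⁻¹ := inv_nonneg.2 hx.le
  rw [Real.norm_eq_abs, Pi.add_apply, ← sq_abs]
  nlinarith [mul_nonneg hinv_nonneg (sq_nonneg (ρ x * |h x| - 1)), abs_nonneg (h x)]

/-- The representative is `η / ρ`, whose square is integrable because `ρ⁻¹` is, locally. -/
lemma exists_integral_mul_eq_inner (hm : IsKufnerOpic U m) {η : ℝ → ℝ}
    (hη : IsTestFunction U η) :
    ∃ k : Lp ℝ 2 m, ∀ (h : ℝ → ℝ) (hh : MemLp h 2 m),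
      ∫ x, h x * η x = inner ℝ (hh.toLp h) k := by
  obtain ⟨ρ, hρ, hpos, hinv, rfl⟩ := hm
  have hnonneg : 0 ≤ᵐ[volume.restrict U] ρ := hpos.mono fun x hx => hx.le
  have hmeas : AEStronglyMeasurable (fun x => η x / ρ x) (volume.restrict U) :=
    (hη.contDiff.continuous.aemeasurable.div hρ).aestronglyMeasurable
  have hk : MemLp (fun x => η x / ρ x) 2
      ((volume.restrict U).withDensity fun x => ENNReal.ofReal (ρ x)) := by
    rw [memLp_two_iff_integrable_sq (hmeas.mono_ac (withDensity_absolutelyContinuous _ _)),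
      integrable_withDensity_ofReal_iff hρ hnonneg]
    refine ((hη.mul_left hη.contDiff).integrable_mul hinv).integrableOn.congr ?_
    filter_upwards [hpos] with x hx
    field_simp
  refine ⟨hk.toLp _, fun h hh => ?_⟩
  rw [inner_toLp_toLp, integral_withDensity_ofReal hρ hnonneg, ← hη.setIntegral_mul]
  refine integral_congr_ae ?_
  filter_upwards [hpos] with x hx
  field_simp

end IsKufnerOpic

/-- The measure `μ` and the weighted measure `w • μ` satisfy the Kufner-Opic condition on `U`: the
setting of the weighted Sobolev space `H¹(μ, w)`. -/
structure IsKufnerOpicPair (U : Set ℝ) (μ : Measure ℝ) (w : ℝ → ℝ) : Prop where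
  aemeasurable : AEMeasurable w μ
  nonneg : 0 ≤ᵐ[μ] w
  measure : IsKufnerOpic U μ
  weighted : IsKufnerOpic U (μ.withDensity fun x => ENNReal.ofReal (w x))

lemma isKufnerOpicPair_of_mem {a b : EReal} {μ : Measure ℝ} {w : ℝ → ℝ}
    (hμ : μ ∈ densityClass a b) (hw : w ∈ weightClass a b) :
    IsKufnerOpicPair (openInterval a b) μ w := by
  obtain ⟨-, ρ, hρ, -, hρpos, rfl⟩ := hμ
  obtain ⟨hw, -, hwpos⟩ := hw
  have hopen := isOpen_openInterval a b
  have hsub : openInterval a b ⊆ closedInterval a b := fun x hx => ⟨hx.1.le, hx.2.le⟩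
  replace hρ := hρ.mono hsub
  replace hw := hw.mono hsub
  have hmem := ae_restrict_mem (μ := volume) hopen.measurableSet
  have hac := withDensity_absolutelyContinuous (volume.restrict (openInterval a b))
    fun x => ENNReal.ofReal (ρ x)
  have hwm := hw.aemeasurable (μ := volume) hopen.measurableSet
  refine ⟨hwm.mono_ac hac, hac (hmem.mono fun x hx => (hwpos x hx).le),
    .of_continuousOn hopen hρ hρpos, ?_⟩
  rw [← withDensity_mul₀ (hρ.aemeasurable hopen.measurableSet).ennreal_ofReal hwm.ennreal_ofReal]
  convert IsKufnerOpic.of_continuousOn hopen (hρ.mul hw)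
    (fun x hx => mul_pos (hρpos x hx) (hwpos x hx)) using 1
  exact withDensity_congr_ae (hmem.mono fun x hx => (ENNReal.ofReal_mul (hρpos x hx).le).symm)

namespace IsWeakDeriv

variable {a b : EReal} {f f' : ℝ → ℝ}

lemma of_differentiableAt (hf : ∀ x ∈ openInterval a b, DifferentiableAt ℝ f x)
    (hf' : LocallyIntegrableOn (deriv f) (openInterval a b)) : IsWeakDeriv a b f (deriv f) := by
  have hfl : LocallyIntegrableOn f (openInterval a b) :=
    ContinuousOn.locallyIntegrableOn (fun x hx => (hf x hx).continuousAt.continuousWithinAt)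
      (isOpen_openInterval a b).measurableSet
  refine ⟨hfl, hf', fun η hη hηc hηsub => ?_⟩
  have hηt : IsTestFunction (openInterval a b) η := ⟨hη, hηc, hηsub⟩
  have hderiv : ∀ x, HasDerivAt (fun x => f x * η x) (deriv f x * η x + f x * deriv η x) x := by
    intro x
    by_cases hx : x ∈ tsupport η
    · exact (hf x (hηsub hx)).hasDerivAt.mul (hη.differentiable (by simp) x).hasDerivAt
    · have hzero : (fun y => f y * η y) =ᶠ[𝓝 x] fun _ => 0 :=
        (notMem_tsupport_iff_eventuallyEq.1 hx).mono fun y hy => by simp [hy]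
      rw [image_eq_zero_of_notMem_tsupport hx, image_eq_zero_of_notMem_tsupport
        fun h => hx (tsupport_deriv_subset h), mul_zero, mul_zero, add_zero]
      exact (hasDerivAt_const x (0 : ℝ)).congr_of_eventuallyEq hzero
  have hint := hηt.integrable_mul hf'
  have hint' := hηt.deriv.integrable_mul hfl
  have hzero := integral_eq_zero_of_hasDerivAt_of_integrable hderiv (hint.add hint')
    (hηt.integrable_mul hfl)
  rw [hηt.deriv.setIntegral_mul, hηt.setIntegral_mul]
  rw [integral_add hint hint'] at hzero
  exact eq_neg_of_add_eq_zero_right hzero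

lemma of_hasSum {m m' : Measure ℝ} (hm : IsKufnerOpic (openInterval a b) m)
    (hm' : IsKufnerOpic (openInterval a b) m') {ι : Type*} {u u' : ι → ℝ → ℝ} {c : ι → ℝ}
    (h : ∀ j, IsWeakDeriv a b (u j) (u' j)) (hu : ∀ j, MemLp (u j) 2 m)
    (hu' : ∀ j, MemLp (u' j) 2 m') (hf : MemLp f 2 m) (hf' : MemLp f' 2 m')
    (hsum : HasSum (fun j => c j • (hu j).toLp (u j)) (hf.toLp f))
    (hsum' : HasSum (fun j => c j • (hu' j).toLp (u' j)) (hf'.toLp f')) :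
    IsWeakDeriv a b f f' := by
  have hopen := isOpen_openInterval a b
  refine ⟨hm.locallyIntegrableOn hopen hf, hm'.locallyIntegrableOn hopen hf',
    fun η hη hηc hηsub => ?_⟩
  have hηt : IsTestFunction (openInterval a b) η := ⟨hη, hηc, hηsub⟩
  obtain ⟨k, hk⟩ := hm.exists_integral_mul_eq_inner hηt.deriv
  obtain ⟨k', hk'⟩ := hm'.exists_integral_mul_eq_inner hηt
  rw [hηt.deriv.setIntegral_mul, hηt.setIntegral_mul, hk f hf, hk' f' hf']
  have hparts : ∀ j, inner ℝ ((hu j).toLp (u j)) k = -inner ℝ ((hu' j).toLp (u' j)) k' := by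
    intro j
    rw [← hk, ← hk', (h j).integral_mul_deriv hηt]
  have hinner : HasSum (fun j => c j * inner ℝ ((hu j).toLp (u j)) k) (inner ℝ (hf.toLp f) k) := by
    simpa only [innerSL_apply_apply, inner_smul_right, real_inner_comm] using
      hsum.mapL (innerSL ℝ k)
  have hinner' : HasSum (fun j => c j * -inner ℝ ((hu' j).toLp (u' j)) k')
      (-inner ℝ (hf'.toLp f') k') := by
    simpa only [innerSL_apply_apply, inner_smul_right, real_inner_comm, mul_neg] using
      (hsum'.mapL (innerSL ℝ k')).neg
  simp only [hparts] at hinner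
  exact hinner.unique hinner'

end IsWeakDeriv

section Orthogonal

variable {𝕜 E ι : Type*} [RCLike 𝕜] [NormedAddCommGroup E] [InnerProductSpace 𝕜 E] {v : ι → E}
  {c : ι → 𝕜}

lemma orthogonalFamily_span_singleton (hv : Pairwise fun j k => inner 𝕜 (v j) (v k) = 0) :
    OrthogonalFamily 𝕜 (fun j => 𝕜 ∙ v j) fun j => (𝕜 ∙ v j).subtypeₗᵢ :=
  .of_pairwise fun j k hjk => Submodule.isOrtho_span.2 <| by simpa using hv hjk

lemma norm_sum_smul_sq (hv : Pairwise fun j k => inner 𝕜 (v j) (v k) = 0) (s : Finset ι) :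
    ‖∑ j ∈ s, c j • v j‖ ^ 2 = ∑ j ∈ s, ‖c j‖ ^ 2 * ‖v j‖ ^ 2 := by
  simpa [norm_smul, mul_pow] using (orthogonalFamily_span_singleton hv).norm_sum
    (fun j => ⟨c j • v j, Submodule.smul_mem _ _ (Submodule.mem_span_singleton_self _)⟩) s

lemma summable_smul_iff_of_orthogonal [CompleteSpace E]
    (hv : Pairwise fun j k => inner 𝕜 (v j) (v k) = 0) :
    Summable (fun j => c j • v j) ↔ Summable fun j => ‖c j‖ ^ 2 * ‖v j‖ ^ 2 := by
  simpa [norm_smul, mul_pow] using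
    (orthogonalFamily_span_singleton hv).summable_iff_norm_sq_summable
      fun j => ⟨c j • v j, Submodule.smul_mem _ _ (Submodule.mem_span_singleton_self _)⟩

lemma tsum_sq_mul_norm_sq_of_hasSum (hv : Pairwise fun j k => inner 𝕜 (v j) (v k) = 0) {x : E}
    (hx : HasSum (fun j => c j • v j) x) : ∑' j, ‖c j‖ ^ 2 * ‖v j‖ ^ 2 = ‖x‖ ^ 2 := by
  refine HasSum.tsum_eq ((Tendsto.norm hx).pow 2 |>.congr fun s => ?_)
  exact norm_sum_smul_sq hv s

lemma sum_sq_mul_norm_sq_le (hv : Pairwise fun j k => inner 𝕜 (v j) (v k) = 0) {x : E}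
    (hx : ∀ j, inner 𝕜 (v j) x = c j * (‖v j‖ : 𝕜) ^ 2) (s : Finset ι) :
    ∑ j ∈ s, ‖c j‖ ^ 2 * ‖v j‖ ^ 2 ≤ ‖x‖ ^ 2 := by
  rw [← norm_sum_smul_sq hv]
  set y := ∑ j ∈ s, c j • v j with hy
  have hinner : inner 𝕜 y x = (‖y‖ : 𝕜) ^ 2 := by
    rw [← RCLike.ofReal_pow, hy, norm_sum_smul_sq hv, sum_inner]
    push_cast
    refine Finset.sum_congr rfl fun j _ => ?_
    rw [inner_smul_left, hx, ← mul_assoc, RCLike.conj_mul]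
  have hle : ‖y‖ ^ 2 ≤ ‖y‖ * ‖x‖ := by
    simpa [hinner] using norm_inner_le_norm (𝕜 := 𝕜) y x
  have hyx : ‖y‖ ≤ ‖x‖ := by
    by_contra! hlt
    nlinarith [norm_nonneg x]
  gcongr

end Orthogonal

section WeightedSobolev

variable {a b : EReal} {μ : Measure ℝ} {w f f' g g' : ℝ → ℝ}

namespace IsKufnerOpicPair

lemma ae_mem (hp : IsKufnerOpicPair (openInterval a b) μ w) : ∀ᵐ x ∂μ, x ∈ openInterval a b :=
  hp.measure.absolutelyContinuous (ae_restrict_mem (isOpen_openInterval a b).measurableSet)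

lemma inner_deriv_eq (hp : IsKufnerOpicPair (openInterval a b) μ w) (hf : MemH1 a b μ w f f')
    (hg : MemH1 a b μ w g g') :
    inner ℝ (hf.2.2.toLp f') (hg.2.2.toLp g') = ∫ x, f' x * g' x * w x ∂μ := by
  rw [inner_toLp_toLp, integral_withDensity_ofReal hp.aemeasurable hp.nonneg]
  simp only [mul_comm]

lemma norm_deriv_sq (hp : IsKufnerOpicPair (openInterval a b) μ w) (hf : MemH1 a b μ w f f') :
    ‖hf.2.2.toLp f'‖ ^ 2 = ∫ x, w x * f' x ^ 2 ∂μ := by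
  rw [← real_inner_self_eq_norm_sq, hp.inner_deriv_eq hf hf]
  simp only [sq, mul_comm]

lemma ofReal_integral_weight_mul_sq (hp : IsKufnerOpicPair (openInterval a b) μ w)
    (hf : MemH1 a b μ w f f') :
    ENNReal.ofReal (∫ x, w x * f' x ^ 2 ∂μ) = ∫⁻ x, ENNReal.ofReal (w x * f' x ^ 2) ∂μ :=
  ofReal_integral_eq_lintegral_ofReal
    ((integrable_withDensity_ofReal_iff hp.aemeasurable hp.nonneg).1 hf.2.2.integrable_sq)
    (hp.nonneg.mono fun x hx => mul_nonneg hx (sq_nonneg (f' x)))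

lemma memH1_deriv (hp : IsKufnerOpicPair (openInterval a b) μ w)
    (hf : ∀ x ∈ openInterval a b, DifferentiableAt ℝ f x) (hf2 : MemLp f 2 μ)
    (hfin : ∫⁻ x, ENNReal.ofReal (w x * deriv f x ^ 2) ∂μ ≠ ⊤) : MemH1 a b μ w f (deriv f) := by
  have hderiv : MemLp (deriv f) 2 (μ.withDensity fun x => ENNReal.ofReal (w x)) := by
    rw [memLp_two_iff_integrable_sq (measurable_deriv f).aestronglyMeasurable,
      integrable_withDensity_ofReal_iff hp.aemeasurable hp.nonneg]
    refine ⟨(hp.aemeasurable.mul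
      ((measurable_deriv f).pow_const 2).aemeasurable).aestronglyMeasurable, ?_⟩
    rw [hasFiniteIntegral_iff_ofReal
      (hp.nonneg.mono fun x hx => mul_nonneg hx (sq_nonneg (deriv f x)))]
    exact hfin.lt_top
  exact ⟨.of_differentiableAt hf
    (hp.weighted.locallyIntegrableOn (isOpen_openInterval a b) hderiv), hf2, hderiv⟩

lemma memH1_const [IsFiniteMeasure μ] (hp : IsKufnerOpicPair (openInterval a b) μ w) (c : ℝ) :
    MemH1 a b μ w (fun _ => c) fun _ => 0 := by
  simpa using hp.memH1_deriv (fun x _ => differentiableAt_const c) (memLp_const c) (by simp)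

end IsKufnerOpicPair

lemma PoincareInequality.evariance_le [IsProbabilityMeasure μ] {C : ℝ}
    (hC : PoincareInequality a b μ w C) (hC0 : 0 < C)
    (hp : IsKufnerOpicPair (openInterval a b) μ w)
    (hf : ∀ x ∈ openInterval a b, DifferentiableAt ℝ f x) (hf2 : MemLp f 2 μ) :
    evariance f μ ≤ ENNReal.ofReal C * ∫⁻ x, ENNReal.ofReal (w x * deriv f x ^ 2) ∂μ := by
  by_cases hfin : ∫⁻ x, ENNReal.ofReal (w x * deriv f x ^ 2) ∂μ = ⊤
  · simp [hfin, ENNReal.mul_top, hC0]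
  set c := ∫ x, f x ∂μ
  have hderiv : deriv (fun x => f x - c) = deriv f := funext fun x => deriv_sub_const c
  have hH1 : MemH1 a b μ w (fun x => f x - c) (deriv f) :=
    hderiv ▸ hp.memH1_deriv (fun x hx => (hf x hx).sub_const c) (hf2.sub (memLp_const c))
      (hderiv ▸ hfin)
  have hmean : ∫ x, f x - c ∂μ = 0 := by
    rw [integral_sub (hf2.integrable one_le_two) (integrable_const c), integral_const,
      probReal_univ, one_smul, sub_self]
  rw [← hp.ofReal_integral_weight_mul_sq hH1, ← ENNReal.ofReal_mul hC0.le, ← ofReal_variance hf2,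
    variance_eq_integral hf2.1.aemeasurable]
  exact ENNReal.ofReal_le_ofReal (hC _ _ hH1 hmean)

end WeightedSobolev

namespace IsPoincareBasis

variable {a b : EReal} {μ : Measure ℝ} {w f f' : ℝ → ℝ} {φ : ℕ → ℝ → ℝ} {lam : ℕ → ℝ}

lemma memLp (h : IsPoincareBasis a b μ w φ lam) (j : ℕ) : MemLp (φ j) 2 μ := by
  obtain ⟨_, hφ, -⟩ := h.eigen j
  exact hφ.2.1

lemma lam_nonneg (h : IsPoincareBasis a b μ w φ lam) (j : ℕ) : 0 ≤ lam j :=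
  h.lam_zero ▸ h.lam_strictMono.monotone (Nat.zero_le j)

lemma lam_pos (h : IsPoincareBasis a b μ w φ lam) {j : ℕ} (hj : j ≠ 0) : 0 < lam j :=
  h.lam_zero ▸ h.lam_strictMono (Nat.pos_of_ne_zero hj)

lemma exists_hilbertBasis (h : IsPoincareBasis a b μ w φ lam) :
    ∃ e : HilbertBasis ℕ ℝ (Lp ℝ 2 μ), ∀ j, e j = (h.memLp j).toLp (φ j) := by
  obtain ⟨e, he⟩ := h.basis
  exact ⟨e, fun j => Lp.ext ((he j).trans (h.memLp j).coeFn_toLp.symm)⟩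

lemma integral_mul_eq (h : IsPoincareBasis a b μ w φ lam) (j k : ℕ) :
    ∫ x, φ j x * φ k x ∂μ = if j = k then 1 else 0 := by
  obtain ⟨e, he⟩ := h.exists_hilbertBasis
  rw [← inner_toLp_toLp (h.memLp j) (h.memLp k), ← he, ← he]
  exact orthonormal_iff_ite.1 e.orthonormal j k

lemma hasSum_smul_toLp (h : IsPoincareBasis a b μ w φ lam) (hf : MemLp f 2 μ) :
    HasSum (fun j => (∫ x, φ j x * f x ∂μ) • (h.memLp j).toLp (φ j)) (hf.toLp f) := by
  obtain ⟨e, he⟩ := h.exists_hilbertBasis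
  simpa only [e.repr_apply_apply, he, inner_toLp_toLp] using e.hasSum_repr (hf.toLp f)

lemma hasSum_integral_mul (h : IsPoincareBasis a b μ w φ lam) (hf : MemLp f 2 μ)
    {g : ℝ → ℝ} (hg : MemLp g 2 μ) :
    HasSum (fun j => (∫ x, f x * φ j x ∂μ) * ∫ x, φ j x * g x ∂μ) (∫ x, f x * g x ∂μ) := by
  obtain ⟨e, he⟩ := h.exists_hilbertBasis
  simpa only [he, inner_toLp_toLp] using e.hasSum_inner_mul_inner (hf.toLp f) (hg.toLp g)

lemma hasSum_sq (h : IsPoincareBasis a b μ w φ lam) (hf : MemLp f 2 μ) :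
    HasSum (fun j => (∫ x, φ j x * f x ∂μ) ^ 2) (∫ x, f x ^ 2 ∂μ) := by
  simpa only [sq, mul_comm (f _) (φ _ _)] using h.hasSum_integral_mul hf hf

/-- The derivative of `φ j`, as an element of `L²(μ, w)`. -/
def derivLp (h : IsPoincareBasis a b μ w φ lam) (j : ℕ) :
    Lp ℝ 2 (μ.withDensity fun x => ENNReal.ofReal (w x)) :=
  (h.eigen j).choose_spec.1.2.2.toLp (h.eigen j).choose

lemma inner_derivLp (h : IsPoincareBasis a b μ w φ lam)
    (hp : IsKufnerOpicPair (openInterval a b) μ w) (hf : MemH1 a b μ w f f') (j : ℕ) :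
    inner ℝ (h.derivLp j) (hf.2.2.toLp f') = lam j * ∫ x, φ j x * f x ∂μ := by
  rw [derivLp, hp.inner_deriv_eq (h.eigen j).choose_spec.1 hf, (h.eigen j).choose_spec.2 f f' hf]

lemma inner_derivLp_derivLp (h : IsPoincareBasis a b μ w φ lam)
    (hp : IsKufnerOpicPair (openInterval a b) μ w) (j k : ℕ) :
    inner ℝ (h.derivLp j) (h.derivLp k) = if j = k then lam j else 0 := by
  rw [derivLp.eq_def h k, h.inner_derivLp hp (h.eigen k).choose_spec.1, h.integral_mul_eq, mul_ite,
    mul_one, mul_zero]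

lemma pairwise_inner_derivLp (h : IsPoincareBasis a b μ w φ lam)
    (hp : IsKufnerOpicPair (openInterval a b) μ w) :
    Pairwise fun j k => inner ℝ (h.derivLp j) (h.derivLp k) = 0 := fun j k hjk =>
  (h.inner_derivLp_derivLp hp j k).trans (if_neg hjk)

lemma norm_derivLp_sq (h : IsPoincareBasis a b μ w φ lam)
    (hp : IsKufnerOpicPair (openInterval a b) μ w) (j : ℕ) : ‖h.derivLp j‖ ^ 2 = lam j := by
  rw [← real_inner_self_eq_norm_sq, h.inner_derivLp_derivLp hp, if_pos rfl]

lemma sum_lam_mul_sq_le (h : IsPoincareBasis a b μ w φ lam)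
    (hp : IsKufnerOpicPair (openInterval a b) μ w) (hf : MemH1 a b μ w f f') (s : Finset ℕ) :
    ∑ j ∈ s, lam j * (∫ x, φ j x * f x ∂μ) ^ 2 ≤ ∫ x, w x * f' x ^ 2 ∂μ := by
  have hle := sum_sq_mul_norm_sq_le (c := fun j => ∫ x, φ j x * f x ∂μ)
    (h.pairwise_inner_derivLp hp) (x := hf.2.2.toLp f') (fun j => ?_) s
  · simpa only [h.norm_derivLp_sq hp, hp.norm_deriv_sq hf, Real.norm_eq_abs, sq_abs,
      mul_comm (_ ^ 2)] using hle
  · rw [h.inner_derivLp hp hf, RCLike.ofReal_real_eq_id, id, h.norm_derivLp_sq hp, mul_comm]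

lemma exists_memH1_of_summable (h : IsPoincareBasis a b μ w φ lam)
    (hp : IsKufnerOpicPair (openInterval a b) μ w) (hf : MemLp f 2 μ)
    (hs : Summable fun j => lam j * (∫ x, φ j x * f x ∂μ) ^ 2) :
    ∃ g, MemH1 a b μ w f g ∧
      ∫ x, w x * g x ^ 2 ∂μ = ∑' j, lam j * (∫ x, φ j x * f x ∂μ) ^ 2 := by
  set c : ℕ → ℝ := fun j => ∫ x, φ j x * f x ∂μ
  have hterm : ∀ j, ‖c j‖ ^ 2 * ‖h.derivLp j‖ ^ 2 = lam j * c j ^ 2 := fun j => by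
    rw [h.norm_derivLp_sq hp, Real.norm_eq_abs, sq_abs, mul_comm]
  obtain ⟨G, hG⟩ := (summable_smul_iff_of_orthogonal (c := c) (h.pairwise_inner_derivLp hp)).2
    (by simpa only [hterm] using hs)
  have hG' : HasSum (fun j => c j • h.derivLp j) ((Lp.memLp G).toLp G) := by
    rwa [Lp.toLp_coeFn]
  have hH1 : MemH1 a b μ w f G :=
    ⟨.of_hasSum hp.measure hp.weighted (fun j => (h.eigen j).choose_spec.1.1) h.memLp
      (fun j => (h.eigen j).choose_spec.1.2.2) hf (Lp.memLp G) (h.hasSum_smul_toLp hf) hG',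
      hf, Lp.memLp G⟩
  refine ⟨G, hH1, ?_⟩
  rw [← hp.norm_deriv_sq hH1, ← tsum_sq_mul_norm_sq_of_hasSum (h.pairwise_inner_derivLp hp) hG']
  exact tsum_congr hterm

theorem lintegral_weight_mul_deriv_sq (h : IsPoincareBasis a b μ w φ lam)
    (hp : IsKufnerOpicPair (openInterval a b) μ w)
    (hf : ∀ x ∈ openInterval a b, DifferentiableAt ℝ f x) (hf2 : MemLp f 2 μ) :
    ∫⁻ x, ENNReal.ofReal (w x * deriv f x ^ 2) ∂μ =
      ∑' j, ENNReal.ofReal (lam j * (∫ x, φ j x * f x ∂μ) ^ 2) := by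
  have hnonneg : ∀ j, 0 ≤ lam j * (∫ x, φ j x * f x ∂μ) ^ 2 := fun j =>
    mul_nonneg (h.lam_nonneg j) (sq_nonneg _)
  by_cases hs : Summable fun j => lam j * (∫ x, φ j x * f x ∂μ) ^ 2
  · obtain ⟨g, hg, henergy⟩ := h.exists_memH1_of_summable hp hf2 hs
    have hderiv : deriv f =ᵐ[μ] g :=
      hp.measure.absolutelyContinuous <|
        (ae_restrict_iff' (isOpen_openInterval a b).measurableSet).2 <|
        hg.1.ae_deriv_eq fun x hx => (hf x hx).continuousAt.continuousWithinAt
    rw [← ENNReal.ofReal_tsum_of_nonneg hnonneg hs, ← henergy, hp.ofReal_integral_weight_mul_sq hg]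
    exact lintegral_congr_ae (hderiv.mono fun x hx => by simp only [hx])
  · trans ⊤
    · by_contra hfin
      exact hs (summable_of_sum_le hnonneg (h.sum_lam_mul_sq_le hp (hp.memH1_deriv hf hf2 hfin)))
    · by_contra hfin
      exact hs (by simpa only [ENNReal.toReal_ofReal (hnonneg _)] using
        ENNReal.summable_toReal (Ne.symm hfin))

lemma integral_eq_zero [IsFiniteMeasure μ] (h : IsPoincareBasis a b μ w φ lam)
    (hp : IsKufnerOpicPair (openInterval a b) μ w) {j : ℕ} (hj : j ≠ 0) : ∫ x, φ j x ∂μ = 0 := by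
  obtain ⟨u, -, hu⟩ := h.eigen j
  have horth := hu _ _ (hp.memH1_const 1)
  simp only [mul_zero, zero_mul, integral_zero, mul_one] at horth
  exact (mul_eq_zero.1 horth.symm).resolve_left (h.lam_pos hj).ne'

/-- Both sides are Parseval's expansions against `1`, of which only the zeroth terms remain:
`0 = ∫ f = (∫ f φ₀) (∫ φ₀)` and `1 = (∫ φ₀)²`. -/
lemma integral_zero_mul_eq_zero [IsProbabilityMeasure μ] (h : IsPoincareBasis a b μ w φ lam)
    (hp : IsKufnerOpicPair (openInterval a b) μ w) (hf : MemLp f 2 μ) (hmean : ∫ x, f x ∂μ = 0) :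
    ∫ x, φ 0 x * f x ∂μ = 0 := by
  have hexpand : ∀ g : ℝ → ℝ, MemLp g 2 μ →
      ∫ x, g x ∂μ = (∫ x, g x * φ 0 x ∂μ) * ∫ x, φ 0 x ∂μ := fun g hg => by
    have hsum := h.hasSum_integral_mul hg (memLp_const 1)
    simp only [mul_one] at hsum
    exact hsum.unique (hasSum_single 0 fun j hj => by rw [h.integral_eq_zero hp hj, mul_zero])
  have hone := hexpand (fun _ => 1) (memLp_const 1)
  have hzero := hexpand f hf
  simp only [integral_const, probReal_univ, smul_eq_mul, one_mul] at hone
  rw [hmean, eq_comm, mul_eq_zero] at hzero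
  simp only [mul_comm (φ 0 _)]
  exact hzero.resolve_right fun h0 => by simp [h0] at hone

lemma poincareInequality [IsProbabilityMeasure μ] (h : IsPoincareBasis a b μ w φ lam)
    (hp : IsKufnerOpicPair (openInterval a b) μ w) : PoincareInequality a b μ w (1 / lam 1) := by
  intro f f' hf hmean
  rw [one_div_mul_eq_div, le_div_iff₀' (h.lam_pos one_ne_zero)]
  refine hasSum_le_of_sum_le ((h.hasSum_sq hf.2.1).mul_left (lam 1)) fun s => ?_
  refine (Finset.sum_le_sum fun j _ => ?_).trans (h.sum_lam_mul_sq_le hp hf s)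
  rcases Nat.eq_zero_or_pos j with rfl | hj
  · simp [h.integral_zero_mul_eq_zero hp hf.2.1 hmean]
  · exact mul_le_mul_of_nonneg_right (h.lam_strictMono.monotone hj) (sq_nonneg _)

/-- The inequality is an equality for `φ 1`. -/
theorem isPoincareConstant [IsProbabilityMeasure μ] (h : IsPoincareBasis a b μ w φ lam)
    (hp : IsKufnerOpicPair (openInterval a b) μ w) : IsPoincareConstant a b μ w (1 / lam 1) := by
  refine ⟨h.poincareInequality hp, fun C hC => ?_⟩
  obtain ⟨u, hu, hu_eigen⟩ := h.eigen 1
  have hnorm : ∫ x, φ 1 x ^ 2 ∂μ = 1 := by simpa [sq] using h.integral_mul_eq 1 1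
  have henergy : ∫ x, w x * u x ^ 2 ∂μ = lam 1 := by
    rw [← hp.norm_deriv_sq hu, ← real_inner_self_eq_norm_sq, hp.inner_deriv_eq hu hu,
      hu_eigen _ _ hu, h.integral_mul_eq, if_pos rfl, mul_one]
  have hle := hC _ _ hu (h.integral_eq_zero hp one_ne_zero)
  rw [hnorm, henergy] at hle
  exact (div_le_iff₀ (h.lam_pos one_ne_zero)).2 hle

end IsPoincareBasis

section Slices

variable {X Y : Type*} [MeasurableSpace X] [MeasurableSpace Y] {m : Measure X} {n : Measure Y}
  {f : X × Y → ℝ} {φ : Y → ℝ} {χ : X → ℝ}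

lemma sq_integral_mul_le {g h : X → ℝ} (hg : MemLp g 2 m) (hh : MemLp h 2 m) :
    (∫ x, g x * h x ∂m) ^ 2 ≤ (∫ x, g x ^ 2 ∂m) * ∫ x, h x ^ 2 ∂m := by
  have hinner := real_inner_mul_inner_self_le (hg.toLp g) (hh.toLp h)
  simpa only [inner_toLp_toLp, ← sq] using hinner

lemma memLp_two_mul_prod (hχ : MemLp χ 2 m) (hφ : MemLp φ 2 n) :
    MemLp (fun p : X × Y => χ p.1 * φ p.2) 2 (m.prod n) := by
  refine (memLp_two_iff_integrable_sq (f := fun p : X × Y => χ p.1 * φ p.2)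
    (hχ.1.comp_fst.mul hφ.1.comp_snd)).2 ?_
  simpa only [mul_pow] using hχ.integrable_sq.mul_prod hφ.integrable_sq

variable [SFinite m] [SFinite n]

lemma ae_memLp_two_slice (hf : MemLp f 2 (m.prod n)) :
    ∀ᵐ x ∂m, MemLp (fun y => f (x, y)) 2 n := by
  filter_upwards [hf.1.prodMk_left, hf.integrable_sq.prod_right_ae] with x hmeas hsq
  exact (memLp_two_iff_integrable_sq hmeas).2 hsq

lemma memLp_two_integral_mul_slice (hf : MemLp f 2 (m.prod n)) (hφ : MemLp φ 2 n) :
    MemLp (fun x => ∫ y, φ y * f (x, y) ∂n) 2 m := by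
  have hmeas : AEStronglyMeasurable (fun x => ∫ y, φ y * f (x, y) ∂n) m :=
    (hφ.1.comp_snd.mul hf.1).integral_prod_right'
  rw [memLp_two_iff_integrable_sq hmeas]
  refine (hf.integrable_sq.integral_prod_left.const_mul (∫ y, φ y ^ 2 ∂n)).mono' (hmeas.pow 2) ?_
  filter_upwards [ae_memLp_two_slice hf] with x hx
  rw [Real.norm_eq_abs, abs_of_nonneg (sq_nonneg _)]
  exact sq_integral_mul_le hφ hx

lemma integral_mul_integral_mul_slice (hf : MemLp f 2 (m.prod n)) (hφ : MemLp φ 2 n)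
    (hχ : MemLp χ 2 m) :
    ∫ x, χ x * ∫ y, φ y * f (x, y) ∂n ∂m = ∫ p, χ p.1 * φ p.2 * f p ∂m.prod n := by
  rw [integral_prod (fun p => χ p.1 * φ p.2 * f p) ((memLp_two_mul_prod hχ hφ).integrable_mul hf)]
  simp only [← integral_const_mul, mul_assoc]

/-- Outside `I` the function is unrelated to `μ`, so that the difference quotients are taken for its
extension by zero. -/
lemma aestronglyMeasurable_deriv_snd {E : Type*} [NormedAddCommGroup E] [NormedSpace ℝ E]
    {μ : Measure ℝ} [SFinite μ] {I : Set ℝ} (hI : IsOpen I) (hμ : μ ≪ volume.restrict I)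
    (hμ' : volume.restrict I ≪ μ) {f : X × ℝ → E} (hf : AEStronglyMeasurable f (m.prod μ))
    (hdiff : ∀ᵐ p ∂m.prod μ, DifferentiableAt ℝ (fun s => f (p.1, s)) p.2) :
    AEStronglyMeasurable (fun p => deriv (fun s => f (p.1, s)) p.2) (m.prod μ) := by
  set G := indicator (univ ×ˢ I : Set (X × ℝ)) f with hG
  have hGI : ∀ (x : X) {t : ℝ}, t ∈ I → G (x, t) = f (x, t) := fun x t ht =>
    indicator_of_mem (mk_mem_prod (mem_univ x) ht) f
  have hGm : AEStronglyMeasurable G (m.prod volume) := by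
    rw [hG, aestronglyMeasurable_indicator_iff (MeasurableSet.univ.prod hI.measurableSet),
      ← Measure.prod_restrict, Measure.restrict_univ]
    exact hf.mono_ac (Measure.AbsolutelyContinuous.rfl.prod hμ')
  have hac : m.prod μ ≪ m.prod volume := Measure.AbsolutelyContinuous.rfl.prod
    (hμ.trans Measure.absolutelyContinuous_restrict)
  have hshift : ∀ c : ℝ, AEStronglyMeasurable (fun p : X × ℝ => G (p.1, p.2 + c)) (m.prod μ) :=
    fun c => (hGm.comp_quasiMeasurePreserving ((MeasurePreserving.id m).prod
      (measurePreserving_add_right volume c)).quasiMeasurePreserving).mono_ac hac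
  have hgap : Tendsto (fun k : ℕ => 1 / ((k : ℝ) + 1)) atTop (𝓝[>] 0) :=
    tendsto_nhdsWithin_iff.2 ⟨tendsto_one_div_add_atTop_nhds_zero_nat,
      Eventually.of_forall fun k => mem_Ioi.2 Nat.one_div_pos_of_nat⟩
  refine aestronglyMeasurable_of_tendsto_ae atTop
    (f := fun (k : ℕ) p =>
      (1 / ((k : ℝ) + 1))⁻¹ • (G (p.1, p.2 + 1 / ((k : ℝ) + 1)) - G (p.1, p.2 + 0)))
    (fun k => ((hshift _).sub (hshift 0)).const_smul _) ?_
  have hmem : ∀ᵐ p ∂m.prod μ, p.2 ∈ I := Measure.quasiMeasurePreserving_snd.ae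
    (hμ (ae_restrict_mem hI.measurableSet))
  filter_upwards [hmem, hdiff] with p hp hdp
  have hin : ∀ᶠ h in 𝓝[>] (0 : ℝ), p.2 + h ∈ I :=
    nhdsWithin_le_nhds ((continuous_const_add p.2).continuousAt.eventually
      (hI.mem_nhds (by simpa using hp)))
  refine (hdp.hasDerivAt.tendsto_slope_zero_right.comp hgap).congr' ?_
  filter_upwards [hgap.eventually hin] with k hk
  simp only [comp_apply, add_zero, hGI p.1 hp, hGI p.1 hk]

end Slices

/-- A family of square integrable functions that satisfies Parseval's identity, stated in `[0, ∞]`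
so that no summability has to be carried along. -/
structure IsParsevalFamily {X ι : Type*} [MeasurableSpace X] (m : Measure X) (φ : ι → X → ℝ) :
    Prop where
  memLp : ∀ i, MemLp (φ i) 2 m
  lintegral_sq : ∀ f : X → ℝ, MemLp f 2 m →
    ∫⁻ x, ENNReal.ofReal (f x ^ 2) ∂m = ∑' i, ENNReal.ofReal ((∫ x, φ i x * f x ∂m) ^ 2)

namespace IsParsevalFamily

variable {X Y ι κ : Type*} [MeasurableSpace X] [MeasurableSpace Y] {m : Measure X} {n : Measure Y}
  {φ : ι → X → ℝ} {χ : κ → Y → ℝ}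

lemma lintegral_integral_slice_sq [SFinite m] [SFinite n] (hφ : IsParsevalFamily m φ)
    {f : X × Y → ℝ} (hf : MemLp f 2 (m.prod n)) {g : Y → ℝ} (hg : MemLp g 2 n) :
    ∫⁻ x, ENNReal.ofReal ((∫ y, g y * f (x, y) ∂n) ^ 2) ∂m =
      ∑' i, ENNReal.ofReal ((∫ p, φ i p.1 * g p.2 * f p ∂m.prod n) ^ 2) := by
  simp only [hφ.lintegral_sq _ (memLp_two_integral_mul_slice hf hg),
    integral_mul_integral_mul_slice hf hg (hφ.memLp _)]

lemma prod [SFinite m] [SFinite n] [Countable κ] (hφ : IsParsevalFamily m φ)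
    (hχ : IsParsevalFamily n χ) :
    IsParsevalFamily (m.prod n) fun (p : κ × ι) (x : X × Y) => φ p.2 x.1 * χ p.1 x.2 := by
  refine ⟨fun p => memLp_two_mul_prod (hφ.memLp _) (hχ.memLp _), fun f hf => ?_⟩
  calc ∫⁻ p, ENNReal.ofReal (f p ^ 2) ∂m.prod n
      = ∫⁻ x, ∫⁻ y, ENNReal.ofReal (f (x, y) ^ 2) ∂n ∂m :=
        lintegral_prod _ (hf.1.aemeasurable.pow_const 2).ennreal_ofReal
    _ = ∫⁻ x, ∑' j, ENNReal.ofReal ((∫ y, χ j y * f (x, y) ∂n) ^ 2) ∂m :=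
        lintegral_congr_ae ((ae_memLp_two_slice hf).mono fun x hx => hχ.lintegral_sq _ hx)
    _ = ∑' j, ∫⁻ x, ENNReal.ofReal ((∫ y, χ j y * f (x, y) ∂n) ^ 2) ∂m :=
        lintegral_tsum fun j =>
          ((memLp_two_integral_mul_slice hf (hχ.memLp j)).1.aemeasurable.pow_const 2).ennreal_ofReal
    _ = _ := by
        simp only [hφ.lintegral_integral_slice_sq hf (hχ.memLp _), ENNReal.tsum_prod']

lemma of_measurePreserving (hφ : IsParsevalFamily m φ) (T : X ≃ᵐ Y) (hT : MeasurePreserving T m n)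
    (σ : ι ≃ κ) (h : ∀ i x, χ (σ i) (T x) = φ i x) : IsParsevalFamily n χ := by
  refine ⟨fun k => ?_, fun f hf => ?_⟩
  · obtain ⟨i, rfl⟩ := σ.surjective k
    rw [← hT.map_eq, T.memLp_map_measure_iff, show χ (σ i) ∘ T = φ i from funext (h i)]
    exact hφ.memLp i
  · have hsum := hφ.lintegral_sq (f ∘ T) (hf.comp_measurePreserving hT)
    simp only [comp_apply, ← h] at hsum
    rw [← hT.lintegral_comp_emb T.measurableEmbedding, ← σ.tsum_eq, hsum]
    simp only [← hT.integral_comp']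

end IsParsevalFamily

lemma IsPoincareBasis.isParsevalFamily {a b : EReal} {μ : Measure ℝ} {w : ℝ → ℝ}
    {φ : ℕ → ℝ → ℝ} {lam : ℕ → ℝ} (h : IsPoincareBasis a b μ w φ lam) :
    IsParsevalFamily μ φ := by
  refine ⟨h.memLp, fun f hf => ?_⟩
  have hsum := h.hasSum_sq hf
  rw [← ENNReal.ofReal_tsum_of_nonneg (fun _ => sq_nonneg _) hsum.summable, hsum.tsum_eq,
    ofReal_integral_eq_lintegral_ofReal hf.integrable_sq (ae_of_all _ fun _ => sq_nonneg _)]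

section InsertNth

variable {n : ℕ} (μ : Fin (n + 1) → Measure ℝ) (i : Fin (n + 1))

/-- The map `(y, t) ↦ i.insertNth t y`, which puts the `i`-th coordinate last. -/
def insertNthMeasurableEquiv : (Fin n → ℝ) × ℝ ≃ᵐ (Fin (n + 1) → ℝ) :=
  MeasurableEquiv.prodComm.trans (MeasurableEquiv.piFinSuccAbove (fun _ => ℝ) i).symm

/-- The law of all coordinates but the `i`-th. -/
abbrev marginal : Measure (Fin n → ℝ) := Measure.pi fun k => μ (i.succAbove k)

lemma insertNthMeasurableEquiv_apply (p : (Fin n → ℝ) × ℝ) :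
    insertNthMeasurableEquiv i p = i.insertNth p.2 p.1 := rfl

lemma measurePreserving_insertNth [∀ k, SigmaFinite (μ k)] :
    MeasurePreserving (insertNthMeasurableEquiv i) ((marginal μ i).prod (μ i)) (Measure.pi μ) :=
  (measurePreserving_piFinSuccAbove μ i).symm.comp Measure.measurePreserving_swap

lemma tensorBasis_insertNth (ψ : Fin (n + 1) → ℕ → ℝ → ℝ) (j : ℕ) (β : Fin n → ℕ) (t : ℝ)
    (y : Fin n → ℝ) :
    tensorBasis ψ (i.insertNth j β) (i.insertNth t y) =
      tensorBasis (fun k => ψ (i.succAbove k)) β y * ψ i j t := by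
  simp only [tensorBasis, Fin.prod_univ_succAbove _ i, Fin.insertNth_apply_same,
    Fin.insertNth_apply_succAbove, mul_comm]

lemma partialDeriv_insertNth (M : (Fin (n + 1) → ℝ) → ℝ) (t : ℝ) (y : Fin n → ℝ) :
    partialDeriv i M (i.insertNth t y) = deriv (fun s => M (i.insertNth s y)) t := by
  simp only [partialDeriv, Fin.update_insertNth, Fin.insertNth_apply_same]

variable [∀ k, IsProbabilityMeasure (μ k)] {M : (Fin (n + 1) → ℝ) → ℝ}

lemma chaosCoeff_insertNth (ψ : Fin (n + 1) → ℕ → ℝ → ℝ) (j : ℕ) (β : Fin n → ℕ) :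
    chaosCoeff μ ψ M (i.insertNth j β) =
      ∫ p, tensorBasis (fun k => ψ (i.succAbove k)) β p.1 * ψ i j p.2 * M (i.insertNth p.2 p.1)
        ∂(marginal μ i).prod (μ i) := by
  rw [chaosCoeff, ← (measurePreserving_insertNth μ i).integral_comp']
  simp only [insertNthMeasurableEquiv_apply, tensorBasis_insertNth, mul_comm (M _)]

variable {μ i}

lemma memLp_comp_insertNth {p : ℝ≥0∞} (hM : MemLp M p (Measure.pi μ)) :
    MemLp (fun q : (Fin n → ℝ) × ℝ => M (i.insertNth q.2 q.1)) p ((marginal μ i).prod (μ i)) :=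
  hM.comp_measurePreserving (measurePreserving_insertNth μ i)

lemma ae_marginal_of_ae_update {S : Set ℝ}
    (hdiff : ∀ᵐ x ∂Measure.pi μ, ∀ t ∈ S,
      DifferentiableAt ℝ (fun s => M (update x i s)) t) :
    ∀ᵐ y ∂marginal μ i, ∀ t ∈ S, DifferentiableAt ℝ (fun s => M (i.insertNth s y)) t := by
  filter_upwards [Measure.ae_ae_of_ae_prod
    ((measurePreserving_insertNth μ i).quasiMeasurePreserving.ae hdiff)] with y hy
  obtain ⟨s, hs⟩ := hy.exists
  exact fun t ht => by
    simpa only [insertNthMeasurableEquiv_apply, Fin.update_insertNth] using hs t ht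

end InsertNth

theorem isParsevalFamily_tensorBasis : ∀ {d : ℕ} (μ : Fin d → Measure ℝ)
    [∀ k, IsProbabilityMeasure (μ k)] (ψ : Fin d → ℕ → ℝ → ℝ),
    (∀ k, IsParsevalFamily (μ k) (ψ k)) → IsParsevalFamily (Measure.pi μ) (tensorBasis ψ)
  | 0, μ, _, ψ, _ => by
    have htensor : tensorBasis ψ = fun _ _ => 1 := by
      ext
      simp only [tensorBasis, Finset.univ_eq_empty, Finset.prod_empty]
    rw [Measure.pi_of_empty μ default, htensor]
    refine ⟨fun _ => memLp_const 1, fun f _ => ?_⟩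
    simp only [lintegral_dirac, integral_dirac, one_mul, tsum_fintype, Finset.univ_unique,
      Finset.sum_singleton]
  | _ + 1, μ, _, ψ, h =>
    ((isParsevalFamily_tensorBasis _ _ fun k => h (Fin.succAbove 0 k)).prod
      (h 0)).of_measurePreserving _ (measurePreserving_insertNth μ 0)
      (Fin.insertNthEquiv (fun _ => ℕ) 0) fun p x => tensorBasis_insertNth 0 ψ _ _ _ _

section Sensitivity

variable {n : ℕ} {μ : Fin (n + 1) → Measure ℝ} [∀ k, IsProbabilityMeasure (μ k)]
  {i : Fin (n + 1)} {a b : EReal} {w : ℝ → ℝ} {M : (Fin (n + 1) → ℝ) → ℝ}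

lemma dgsm_eq_lintegral_slice (hp : IsKufnerOpicPair (openInterval a b) (μ i) w)
    (hM : AEStronglyMeasurable M (Measure.pi μ))
    (hdiff : ∀ᵐ y ∂marginal μ i, ∀ t ∈ openInterval a b,
      DifferentiableAt ℝ (fun s => M (i.insertNth s y)) t) :
    dgsm μ w i M = ∫⁻ y, ∫⁻ t, ENNReal.ofReal
      (w t * deriv (fun s => M (i.insertNth s y)) t ^ 2) ∂μ i ∂marginal μ i := by
  have hdiff' : ∀ᵐ p ∂(marginal μ i).prod (μ i),
      DifferentiableAt ℝ (fun s => M (i.insertNth s p.1)) p.2 := by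
    filter_upwards [Measure.quasiMeasurePreserving_fst.ae hdiff,
      Measure.quasiMeasurePreserving_snd.ae hp.ae_mem] with p hp1 hp2 using hp1 _ hp2
  have hderiv := aestronglyMeasurable_deriv_snd (isOpen_openInterval a b)
    hp.measure.absolutelyContinuous hp.measure.restrict_absolutelyContinuous
    (hM.comp_measurePreserving (measurePreserving_insertNth μ i)) hdiff'
  rw [dgsm, ← (measurePreserving_insertNth μ i).lintegral_comp_emb
    (insertNthMeasurableEquiv i).measurableEmbedding]
  trans ∫⁻ p, ENNReal.ofReal (w p.2 * deriv (fun s => M (i.insertNth s p.1)) p.2 ^ 2)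
      ∂(marginal μ i).prod (μ i)
  · exact lintegral_congr fun p => by
      simp only [insertNthMeasurableEquiv_apply, Fin.insertNth_apply_same, partialDeriv_insertNth]
  · exact lintegral_prod _ ((hp.aemeasurable.comp_quasiMeasurePreserving
      Measure.quasiMeasurePreserving_snd).mul (hderiv.aemeasurable.pow_const 2)).ennreal_ofReal

theorem dgsm_eq_tsum {ψ : Fin (n + 1) → ℕ → ℝ → ℝ} {lam : ℕ → ℝ}
    (hp : IsKufnerOpicPair (openInterval a b) (μ i) w)
    (hbasis : IsPoincareBasis a b (μ i) w (ψ i) lam)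
    (hψ : ∀ k, k ≠ i → IsParsevalFamily (μ k) (ψ k)) (hM : MemLp M 2 (Measure.pi μ))
    (hdiff : ∀ᵐ y ∂marginal μ i, ∀ t ∈ openInterval a b,
      DifferentiableAt ℝ (fun s => M (i.insertNth s y)) t) :
    dgsm μ w i M = ∑' α, ENNReal.ofReal (lam (α i) * chaosCoeff μ ψ M α ^ 2) := by
  have hM' := memLp_comp_insertNth (i := i) hM
  have htensor := isParsevalFamily_tensorBasis (fun k => μ (i.succAbove k))
    (fun k => ψ (i.succAbove k)) fun k => hψ _ (i.succAbove_ne k)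
  calc dgsm μ w i M
      = ∫⁻ y, ∫⁻ t, ENNReal.ofReal
          (w t * deriv (fun s => M (i.insertNth s y)) t ^ 2) ∂μ i ∂marginal μ i :=
        dgsm_eq_lintegral_slice hp hM.1 hdiff
    _ = ∫⁻ y, ∑' j, ENNReal.ofReal
          (lam j * (∫ t, ψ i j t * M (i.insertNth t y) ∂μ i) ^ 2) ∂marginal μ i := by
        refine lintegral_congr_ae ?_
        filter_upwards [hdiff, ae_memLp_two_slice hM'] with y hy hy2
        exact hbasis.lintegral_weight_mul_deriv_sq hp hy hy2
    _ = ∑' j, ENNReal.ofReal (lam j) * ∫⁻ y, ENNReal.ofReal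
          ((∫ t, ψ i j t * M (i.insertNth t y) ∂μ i) ^ 2) ∂marginal μ i := by
        simp only [ENNReal.ofReal_mul (hbasis.lam_nonneg _)]
        rw [lintegral_tsum fun j => ((memLp_two_integral_mul_slice hM'
          (hbasis.memLp j)).1.aemeasurable.pow_const 2).ennreal_ofReal.const_mul _]
        simp only [lintegral_const_mul' _ _ ENNReal.ofReal_ne_top]
    _ = ∑' (j) (β : Fin n → ℕ), ENNReal.ofReal
          (lam j * chaosCoeff μ ψ M (i.insertNth j β) ^ 2) := by
        simp only [htensor.lintegral_integral_slice_sq hM' (hbasis.memLp _),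
          chaosCoeff_insertNth, ENNReal.ofReal_mul (hbasis.lam_nonneg _), ENNReal.tsum_mul_left]
    _ = ∑' α, ENNReal.ofReal (lam (α i) * chaosCoeff μ ψ M α ^ 2) := by
        rw [← (Fin.insertNthEquiv (fun _ => ℕ) i).tsum_eq, ENNReal.tsum_prod']
        refine tsum_congr fun j => tsum_congr fun β => ?_
        rw [show Fin.insertNthEquiv (fun _ => ℕ) i (j, β) = i.insertNth j β from rfl,
          Fin.insertNth_apply_same]

end Sensitivity

section CoordAverage

variable {ι : Type*} [Fintype ι] {X : ι → Type*} [∀ i, MeasurableSpace (X i)]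
  {E : Type*} [NormedAddCommGroup E] {μ : ∀ i, Measure (X i)} {f g : (∀ i, X i) → E}
  {I J : Finset ι}

lemma piFinset_univ : Filtration.piFinset (X := X) Finset.univ = MeasurableSpace.pi := by
  refine le_antisymm (Filtration.piFinset.le _) (iSup_le fun i => ?_)
  have hrestrict : Measurable[Filtration.piFinset Finset.univ]
      (Finset.univ.restrict : (∀ i, X i) → _) := comap_measurable _
  exact ((measurable_pi_apply (⟨i, Finset.mem_univ i⟩ : Finset.univ (α := ι))).comp
    hrestrict).comap_le

variable [DecidableEq ι]

lemma measurePreserving_updateFinset [∀ i, IsProbabilityMeasure (μ i)] (J : Finset ι) :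
    MeasurePreserving (fun p : (∀ i, X i) × (∀ i, X i) => updateFinset p.2 J (J.restrict p.1))
      ((Measure.pi μ).prod (Measure.pi μ)) (Measure.pi μ) := by
  have hmeas : Measurable fun p : (∀ i, X i) × (∀ i, X i) =>
      updateFinset p.2 J (J.restrict p.1) := by
    refine measurable_pi_lambda _ fun i => ?_
    by_cases hi : i ∈ J <;> simp only [updateFinset_def, hi, dite_true, dite_false] <;> fun_prop
  refine ⟨hmeas, (Measure.pi_eq fun s hs => ?_).symm⟩
  have hpreimage : (fun p : (∀ i, X i) × (∀ i, X i) => updateFinset p.2 J (J.restrict p.1)) ⁻¹'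
      univ.pi s = (univ.pi fun i => if i ∈ J then s i else univ) ×ˢ
        univ.pi fun i => if i ∈ J then univ else s i := by
    ext p
    simp only [mem_preimage, Set.mem_pi, mem_prod, mem_univ, true_implies, ← forall_and]
    refine forall_congr' fun i => ?_
    by_cases hi : i ∈ J <;> simp [updateFinset_def, hi]
  rw [Measure.map_apply hmeas (.univ_pi hs), hpreimage, Measure.prod_prod, Measure.pi_pi,
    Measure.pi_pi, ← Finset.prod_mul_distrib]
  refine Finset.prod_congr rfl fun i _ => ?_
  by_cases hi : i ∈ J <;> simp [hi]

variable [NormedSpace ℝ E]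

variable (μ) in
/-- The average of `f` over the coordinates outside `J`, a version of the conditional expectation
given the coordinates in `J`. It integrates over all coordinates, which spares a dependent type for
those outside `J`. -/
def coordAverage (J : Finset ι) (f : (∀ i, X i) → E) (x : ∀ i, X i) : E :=
  ∫ y, f (updateFinset y J (J.restrict x)) ∂Measure.pi μ

lemma coordAverage_eq_inter_of_dependsOn (hf : DependsOn f I) :
    coordAverage μ J f = coordAverage μ (I ∩ J) f := by
  funext x
  refine integral_congr_ae (ae_of_all _ fun y => ?_)
  refine hf fun i hi => ?_
  simp only [updateFinset_def, Finset.mem_inter, Finset.mem_coe.1 hi, true_and,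
    Finset.restrict_def]

lemma coordAverage_indicator {s : Set (∀ i, X i)}
    (hs : MeasurableSet[Filtration.piFinset J] s) :
    coordAverage μ J (s.indicator f) = s.indicator (coordAverage μ J f) := by
  obtain ⟨A, -, rfl⟩ := hs
  funext x
  have hmem (y) : updateFinset y J (J.restrict x) ∈ J.restrict ⁻¹' A ↔ x ∈ J.restrict ⁻¹' A := by
    simp only [mem_preimage, restrict_updateFinset]
  by_cases hx : x ∈ J.restrict ⁻¹' A
  · simp only [coordAverage, indicator_of_mem hx, indicator_of_mem ((hmem _).2 hx)]
  · simp only [coordAverage, indicator_of_notMem hx, indicator_of_notMem (mt (hmem _).1 hx),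
      integral_zero]

variable [∀ i, IsProbabilityMeasure (μ i)]

lemma coordAverage_eq_self_of_dependsOn [CompleteSpace E] (hf : DependsOn f I) (h : I ⊆ J) :
    coordAverage μ J f = f := by
  funext x
  have hconst (y) : f (updateFinset y J (J.restrict x)) = f x := by
    refine hf fun i hi => ?_
    simp only [updateFinset_def, dif_pos (h hi), Finset.restrict_def]
  simp only [coordAverage, hconst, integral_const, probReal_univ, one_smul]

lemma coordAverage_congr_ae (J : Finset ι) (h : f =ᵐ[Measure.pi μ] g) :
    coordAverage μ J f =ᵐ[Measure.pi μ] coordAverage μ J g := by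
  filter_upwards [Measure.ae_ae_of_ae_prod
    ((measurePreserving_updateFinset J).quasiMeasurePreserving.ae h)] with x hx
  exact integral_congr_ae hx

lemma stronglyMeasurable_coordAverage (J : Finset ι) (hf : StronglyMeasurable f) :
    StronglyMeasurable[Filtration.piFinset J] (coordAverage μ J f) := by
  have hmeas : Measurable fun p : (∀ i : J, X i) × (∀ i, X i) => updateFinset p.2 J p.1 := by
    refine measurable_pi_lambda _ fun i => ?_
    by_cases hi : i ∈ J <;> simp only [updateFinset_def, hi, dite_true, dite_false] <;> fun_prop
  have hrestrict : Measurable[Filtration.piFinset J] (J.restrict : (∀ i, X i) → _) :=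
    comap_measurable _
  exact ((hf.comp_measurable hmeas).integral_prod_right' (ν := Measure.pi μ)).comp_measurable
    hrestrict

lemma integrable_coordAverage (J : Finset ι) (hf : Integrable f (Measure.pi μ)) :
    Integrable (coordAverage μ J f) (Measure.pi μ) :=
  ((measurePreserving_updateFinset J).integrable_comp_of_integrable hf).integral_prod_left

lemma integral_coordAverage (J : Finset ι) (hf : Integrable f (Measure.pi μ)) :
    ∫ x, coordAverage μ J f x ∂Measure.pi μ = ∫ x, f x ∂Measure.pi μ := by
  have hmp := measurePreserving_updateFinset (μ := μ) J
  have hmap := integral_map (f := f) hmp.aemeasurable (by rw [hmp.map_eq]; exact hf.1)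
  rw [hmp.map_eq] at hmap
  rw [hmap]
  exact (integral_prod _ (hmp.integrable_comp_of_integrable hf)).symm

lemma coordAverage_compl_singleton {i : ι} {x : ∀ i, X i}
    (hf : AEStronglyMeasurable (fun t => f (update x i t)) (μ i)) :
    coordAverage μ {i}ᶜ f x = ∫ t, f (update x i t) ∂μ i := by
  have hupdate (y) : updateFinset y {i}ᶜ (({i}ᶜ : Finset ι).restrict x) = update x i (y i) := by
    funext j
    by_cases hj : j = i
    · subst hj
      simp [updateFinset_def]
    · simp [updateFinset_def, hj]
  rw [← (measurePreserving_eval μ i).map_eq] at hf ⊢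
  rw [integral_map (measurable_pi_apply i).aemeasurable hf]
  simp only [coordAverage, hupdate]

theorem condExp_piFinset_ae_eq [CompleteSpace E] (J : Finset ι)
    (hf : Integrable f (Measure.pi μ)) :
    (Measure.pi μ)[f | Filtration.piFinset J] =ᵐ[Measure.pi μ] coordAverage μ J f := by
  have hmk := hf.congr hf.1.ae_eq_mk
  suffices h : coordAverage μ J (hf.1.mk f) =ᵐ[Measure.pi μ]
      (Measure.pi μ)[hf.1.mk f | Filtration.piFinset J] from
    (condExp_congr_ae hf.1.ae_eq_mk).trans (h.symm.trans
      (coordAverage_congr_ae J hf.1.ae_eq_mk.symm))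
  refine ae_eq_condExp_of_forall_setIntegral_eq (Filtration.piFinset.le J) hmk
    (fun _ _ _ => (integrable_coordAverage J hmk).integrableOn) (fun s hs _ => ?_)
    (stronglyMeasurable_coordAverage J hf.1.stronglyMeasurable_mk).aestronglyMeasurable
  have hs' := Filtration.piFinset.le J s hs
  rw [← integral_indicator hs', ← integral_indicator hs', ← coordAverage_indicator hs,
    integral_coordAverage J (hmk.indicator hs')]

end CoordAverage

section CondExp

variable {ι : Type*} [Fintype ι] {X : ι → Type*} [∀ i, MeasurableSpace (X i)]
  {E : Type*} [NormedAddCommGroup E] [NormedSpace ℝ E] [CompleteSpace E]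
  {μ : ∀ i, Measure (X i)} [∀ i, IsProbabilityMeasure (μ i)] {f : (∀ i, X i) → E} {I J : Finset ι}

lemma condExp_piFinset_of_dependsOn (hf : Integrable f (Measure.pi μ))
    (hI : DependsOn f I) (h : I ⊆ J) :
    (Measure.pi μ)[f | Filtration.piFinset J] =ᵐ[Measure.pi μ] f := by
  classical
  simpa only [coordAverage_eq_self_of_dependsOn hI h] using condExp_piFinset_ae_eq J hf

variable [DecidableEq ι]

lemma condExp_piFinset_inter_of_dependsOn (hf : Integrable f (Measure.pi μ))
    (hI : DependsOn f I) (J : Finset ι) :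
    (Measure.pi μ)[f | Filtration.piFinset J] =ᵐ[Measure.pi μ]
      (Measure.pi μ)[f | Filtration.piFinset (I ∩ J)] := by
  refine (condExp_piFinset_ae_eq J hf).trans ?_
  rw [coordAverage_eq_inter_of_dependsOn hI]
  exact (condExp_piFinset_ae_eq (I ∩ J) hf).symm

theorem condExp_piFinset_condExp_piFinset (f : (∀ i, X i) → E)
    (I J : Finset ι) :
    (Measure.pi μ)[(Measure.pi μ)[f | Filtration.piFinset I] | Filtration.piFinset J]
      =ᵐ[Measure.pi μ] (Measure.pi μ)[f | Filtration.piFinset (I ∩ J)] :=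
  (condExp_piFinset_inter_of_dependsOn integrable_condExp
    stronglyMeasurable_condExp.dependsOn_of_piFinset J).trans
    (condExp_condExp_of_le (Filtration.piFinset.mono Finset.inter_subset_left)
      (Filtration.piFinset.le I))

end CondExp

section AlternatingSum

variable {ι : Type*} [DecidableEq ι] {G : Type*} [AddCommGroup G]

/-- The Möbius inverse, along inclusion, of a function on finite sets. -/
def alternatingSum (F : Finset ι → G) (I : Finset ι) : G :=
  ∑ K ∈ I.powerset, (-1 : ℤ) ^ (I \ K).card • F K

lemma alternatingSum_insert {i : ι} {I : Finset ι} (hi : i ∉ I) (F : Finset ι → G) :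
    alternatingSum F (insert i I) =
      alternatingSum (fun K => F (insert i K)) I - alternatingSum F I := by
  have hout : ∀ K ∈ I.powerset, (-1 : ℤ) ^ (insert i I \ K).card • F K =
      -((-1 : ℤ) ^ (I \ K).card • F K) := fun K hK => by
    have hiK : i ∉ K := fun h => hi (Finset.mem_powerset.1 hK h)
    rw [Finset.insert_sdiff_of_notMem I hiK, Finset.card_insert_of_notMem (by simp [hi]),
      pow_succ, mul_neg_one, neg_smul]
  have hin : ∀ K ∈ I.powerset, (-1 : ℤ) ^ (insert i I \ insert i K).card • F (insert i K) =
      (-1 : ℤ) ^ (I \ K).card • F (insert i K) := fun K _ => by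
    rw [Finset.insert_sdiff_insert, Finset.sdiff_insert_of_notMem hi]
  rw [alternatingSum, Finset.sum_powerset_insert hi, Finset.sum_congr rfl hout,
    Finset.sum_congr rfl hin, Finset.sum_neg_distrib, neg_add_eq_sub]
  rfl

lemma sum_powerset_alternatingSum (F : Finset ι → G) (S : Finset ι) :
    ∑ I ∈ S.powerset, alternatingSum F I = F S := by
  induction S using Finset.induction generalizing F with
  | empty => simp [alternatingSum]
  | insert i S hi ih =>
    have hinsert : ∀ I ∈ S.powerset, alternatingSum F (insert i I) =
        alternatingSum (fun K => F (insert i K)) I - alternatingSum F I := fun I hI =>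
      alternatingSum_insert (fun h => hi (Finset.mem_powerset.1 hI h)) F
    rw [Finset.sum_powerset_insert hi, Finset.sum_congr rfl hinsert, Finset.sum_sub_distrib,
      add_sub_cancel, ih]

lemma alternatingSum_eq_zero {i : ι} {I : Finset ι} (hi : i ∈ I) {F : Finset ι → G}
    (hF : ∀ K, F (insert i K) = F K) : alternatingSum F I = 0 := by
  rw [← Finset.insert_erase hi, alternatingSum_insert (Finset.notMem_erase i I)]
  simp only [hF, sub_self]

end AlternatingSum

section Hoeffding

variable {ι : Type*} {X : ι → Type*} [∀ i, MeasurableSpace (X i)]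

/-- A family of square integrable functions, that of index `I` depending only on the coordinates
in `I` and having conditional expectation zero given those in any strict subset of `I`. -/
structure IsHoeffdingFamily (P : Measure (∀ i, X i)) (T : Finset ι → (∀ i, X i) → ℝ) :
    Prop where
  memLp : ∀ I, MemLp (T I) 2 P
  dependsOn : ∀ I, DependsOn (T I) I
  condExp_eq_zero : ∀ I J, J ⊂ I → P[T I | Filtration.piFinset J] =ᵐ[P] 0

namespace IsHoeffdingFamily

lemma integral_eq_zero {P : Measure (∀ i, X i)} [IsFiniteMeasure P]
    {T : Finset ι → (∀ i, X i) → ℝ} (hT : IsHoeffdingFamily P T) {I : Finset ι}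
    (hI : I.Nonempty) : ∫ x, T I x ∂P = 0 := by
  rw [← integral_condExp (Filtration.piFinset.le ∅),
    integral_congr_ae (hT.condExp_eq_zero I ∅ hI.empty_ssubset)]
  exact integral_zero _ _

variable [Fintype ι] {μ : ∀ i, Measure (X i)} [∀ i, IsProbabilityMeasure (μ i)]
  {T : Finset ι → (∀ i, X i) → ℝ} {I J : Finset ι}

lemma condExp_of_subset (hT : IsHoeffdingFamily (Measure.pi μ) T) (h : I ⊆ J) :
    (Measure.pi μ)[T I | Filtration.piFinset J] =ᵐ[Measure.pi μ] T I :=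
  condExp_piFinset_of_dependsOn ((hT.memLp I).integrable one_le_two) (hT.dependsOn I) h

lemma condExp_of_not_subset (hT : IsHoeffdingFamily (Measure.pi μ) T) (h : ¬I ⊆ J) :
    (Measure.pi μ)[T I | Filtration.piFinset J] =ᵐ[Measure.pi μ] 0 := by
  classical
  exact (condExp_piFinset_inter_of_dependsOn ((hT.memLp I).integrable one_le_two)
    (hT.dependsOn I) J).trans (hT.condExp_eq_zero I (I ∩ J)
      (Finset.inter_subset_left.ssubset_of_ne (mt Finset.inter_eq_left.1 h)))

lemma integral_mul_eq_zero (hT : IsHoeffdingFamily (Measure.pi μ) T) (hIJ : I ≠ J) :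
    ∫ x, T I x * T J x ∂Measure.pi μ = 0 := by
  wlog h : ¬I ⊆ J generalizing I J
  · simpa only [mul_comm] using this hIJ.symm fun hJI => hIJ ((not_not.1 h).antisymm hJI)
  have hmeas : AEStronglyMeasurable[Filtration.piFinset J] (T J) (Measure.pi μ) :=
    ⟨_, stronglyMeasurable_condExp, (hT.condExp_of_subset Finset.Subset.rfl).symm⟩
  have hint : Integrable (T I * T J) (Measure.pi μ) := (hT.memLp I).integrable_mul (hT.memLp J)
  calc ∫ x, T I x * T J x ∂Measure.pi μ
    _ = ∫ x, ((Measure.pi μ)[T I * T J | Filtration.piFinset J]) x ∂Measure.pi μ :=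
        (integral_condExp (Filtration.piFinset.le J)).symm
    _ = ∫ _, (0 : ℝ) ∂Measure.pi μ := by
        refine integral_congr_ae ?_
        filter_upwards [condExp_mul_of_aestronglyMeasurable_right hmeas hint
          ((hT.memLp I).integrable one_le_two), hT.condExp_of_not_subset h] with x hmul hzero
        rw [hmul, Pi.mul_apply, hzero, Pi.zero_apply, zero_mul]
    _ = 0 := integral_zero _ _

lemma covariance_eq_zero (hT : IsHoeffdingFamily (Measure.pi μ) T) (hIJ : I ≠ J) :
    cov[T I, T J; Measure.pi μ] = 0 := by
  have hmean : (∫ x, T I x ∂Measure.pi μ) * ∫ x, T J x ∂Measure.pi μ = 0 := by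
    rcases I.eq_empty_or_nonempty with rfl | hI
    · rw [hT.integral_eq_zero (Finset.nonempty_iff_ne_empty.2 hIJ.symm), mul_zero]
    · rw [hT.integral_eq_zero hI, zero_mul]
  rw [covariance_eq_sub (hT.memLp I) (hT.memLp J), hmean, sub_zero]
  exact hT.integral_mul_eq_zero hIJ

lemma variance_sum (hT : IsHoeffdingFamily (Measure.pi μ) T) (S : Finset (Finset ι)) :
    Var[∑ I ∈ S, T I; Measure.pi μ] = ∑ I ∈ S, Var[T I; Measure.pi μ] := by
  rw [variance_sum' fun I _ => hT.memLp I]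
  refine Finset.sum_congr rfl fun I hI => ?_
  rw [Finset.sum_eq_single_of_mem I hI fun J _ hJ => hT.covariance_eq_zero hJ.symm,
    covariance_self (hT.memLp I).1.aemeasurable]

variable [DecidableEq ι] {f : (∀ i, X i) → ℝ}

lemma sum_mem_ae_eq_sub_condExp (hT : IsHoeffdingFamily (Measure.pi μ) T)
    (hf : f =ᵐ[Measure.pi μ] ∑ I, T I) (i : ι) :
    ∑ I with i ∈ I, T I =ᵐ[Measure.pi μ]
      f - (Measure.pi μ)[f | Filtration.piFinset {i}ᶜ] := by
  have hcond : (Measure.pi μ)[f | Filtration.piFinset {i}ᶜ] =ᵐ[Measure.pi μ]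
      ∑ I with i ∉ I, T I := by
    rw [Finset.sum_filter]
    refine (condExp_congr_ae hf).trans ((condExp_finsetSum (fun I _ =>
      (hT.memLp I).integrable one_le_two) _).trans (eventuallyEq_sum fun I _ => ?_))
    split_ifs with hi
    · exact hT.condExp_of_not_subset fun h => by simpa using h hi
    · exact hT.condExp_of_subset fun j hj => by simpa using ne_of_mem_of_not_mem hj hi
  refine EventuallyEq.trans ?_ (hf.sub hcond).symm
  rw [← Finset.sum_filter_add_sum_filter_not Finset.univ (fun I => i ∈ I) T, add_sub_cancel_right]

theorem sum_variance_mem (hT : IsHoeffdingFamily (Measure.pi μ) T)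
    (hf : f =ᵐ[Measure.pi μ] ∑ I, T I) (i : ι) :
    ∑ I with i ∈ I, Var[T I; Measure.pi μ] =
      Var[f - (Measure.pi μ)[f | Filtration.piFinset {i}ᶜ]; Measure.pi μ] := by
  rw [← hT.variance_sum, variance_congr (hT.sum_mem_ae_eq_sub_condExp hf i)]

end IsHoeffdingFamily

variable [DecidableEq ι]

/-- The term of index `I` in the Sobol'–Hoeffding decomposition of `f`: the inclusion–exclusion
`∑ K ⊆ I, (-1) ^ #(I \ K) • 𝔼[f | X_K]`. -/
def hoeffdingTerm (P : Measure (∀ i, X i)) (f : (∀ i, X i) → ℝ) (I : Finset ι) :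
    (∀ i, X i) → ℝ :=
  alternatingSum (fun K => P[f | Filtration.piFinset K]) I

lemma stronglyMeasurable_hoeffdingTerm (P : Measure (∀ i, X i)) (f : (∀ i, X i) → ℝ)
    (I : Finset ι) : StronglyMeasurable[Filtration.piFinset I] (hoeffdingTerm P f I) := by
  refine Finset.stronglyMeasurable_sum _ fun K hK => ?_
  simp only [← Int.cast_smul_eq_zsmul ℝ]
  exact (stronglyMeasurable_condExp.mono
    (Filtration.piFinset.mono (Finset.mem_powerset.1 hK))).const_smul _

lemma memLp_hoeffdingTerm {P : Measure (∀ i, X i)} {f : (∀ i, X i) → ℝ} (hf : MemLp f 2 P)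
    (I : Finset ι) : MemLp (hoeffdingTerm P f I) 2 P := by
  refine memLp_finsetSum' _ fun K _ => ?_
  simp only [← Int.cast_smul_eq_zsmul ℝ]
  exact (hf.condExp one_le_two).const_smul _

variable [Fintype ι]

lemma sum_hoeffdingTerm_ae_eq {P : Measure (∀ i, X i)} [IsFiniteMeasure P]
    {f : (∀ i, X i) → ℝ} (hf : Integrable f P) : ∑ I, hoeffdingTerm P f I =ᵐ[P] f := by
  simp only [hoeffdingTerm]
  rw [← Finset.powerset_univ, sum_powerset_alternatingSum, piFinset_univ]
  exact condExp_of_aestronglyMeasurable' le_rfl hf.1 hf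

variable {μ : ∀ i, Measure (X i)} [∀ i, IsProbabilityMeasure (μ i)] {f : (∀ i, X i) → ℝ}

lemma condExp_hoeffdingTerm_ae_eq_zero {I J : Finset ι} (h : ¬I ⊆ J) :
    (Measure.pi μ)[hoeffdingTerm (Measure.pi μ) f I | Filtration.piFinset J]
      =ᵐ[Measure.pi μ] 0 := by
  obtain ⟨i, hiI, hiJ⟩ := Finset.not_subset.1 h
  have hzero : alternatingSum
      (fun K => (Measure.pi μ)[f | Filtration.piFinset (K ∩ J)]) I = 0 :=
    alternatingSum_eq_zero hiI fun K => by rw [Finset.insert_inter_of_notMem hiJ]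
  rw [← hzero]
  simp only [hoeffdingTerm, alternatingSum, ← Int.cast_smul_eq_zsmul ℝ]
  refine (condExp_finsetSum (fun K _ => integrable_condExp.smul _) _).trans
    (eventuallyEq_sum fun K _ => ?_)
  exact (condExp_smul _ _ _).trans ((condExp_piFinset_condExp_piFinset f K J).const_smul _)

lemma isHoeffdingFamily_hoeffdingTerm (hf : MemLp f 2 (Measure.pi μ)) :
    IsHoeffdingFamily (Measure.pi μ) (hoeffdingTerm (Measure.pi μ) f) where
  memLp := memLp_hoeffdingTerm hf
  dependsOn I := (stronglyMeasurable_hoeffdingTerm _ f I).dependsOn_of_piFinset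
  condExp_eq_zero _ _ h := condExp_hoeffdingTerm_ae_eq_zero h.not_subset

end Hoeffding

section TotalIndex

lemma IsSobolHoeffding.isHoeffdingFamily {d : ℕ} {P : Measure (Fin d → ℝ)}
    {M : (Fin d → ℝ) → ℝ} {N : (I : Finset (Fin d)) → (I → ℝ) → ℝ}
    (hN : IsSobolHoeffding P M N) : IsHoeffdingFamily P fun I x => N I (I.restrict x) where
  memLp := hN.memLp
  dependsOn I := dependsOn_iff_exists_comp.2 ⟨N I, rfl⟩
  condExp_eq_zero := hN.condExp_eq_zero

theorem exists_isSobolHoeffding {d : ℕ} {μ : Fin d → Measure ℝ} [∀ k, IsProbabilityMeasure (μ k)]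
    {M : (Fin d → ℝ) → ℝ} (hM : MemLp M 2 (Measure.pi μ)) :
    ∃ N : (I : Finset (Fin d)) → (I → ℝ) → ℝ, IsSobolHoeffding (Measure.pi μ) M N := by
  have hT := isHoeffdingFamily_hoeffdingTerm hM
  choose N hN using fun I => dependsOn_iff_exists_comp.1 (hT.dependsOn I)
  have hN' (I) : (fun x => N I (I.restrict x)) = hoeffdingTerm (Measure.pi μ) M I := (hN I).symm
  refine ⟨N, fun I => hN' I ▸ hT.memLp I, ?_, fun I => hN' I ▸ hT.condExp_eq_zero I⟩
  refine (sum_hoeffdingTerm_ae_eq (hM.integrable one_le_two)).symm.trans (Eq.eventuallyEq ?_)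
  funext x
  simp only [← hN', Finset.sum_apply]

variable {n : ℕ} {μ : Fin (n + 1) → Measure ℝ} [∀ k, IsProbabilityMeasure (μ k)]
  {i : Fin (n + 1)} {a b : EReal} {w : ℝ → ℝ} {M : (Fin (n + 1) → ℝ) → ℝ}

lemma ofReal_variance_sub_condExp_compl (hM : MemLp M 2 (Measure.pi μ)) :
    ENNReal.ofReal Var[M - (Measure.pi μ)[M | Filtration.piFinset {i}ᶜ]; Measure.pi μ] =
      ∫⁻ y, evariance (fun t => M (i.insertNth t y)) (μ i) ∂marginal μ i := by
  have hint := hM.integrable one_le_two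
  have hmean : ∫ x, (M - (Measure.pi μ)[M | Filtration.piFinset {i}ᶜ]) x ∂Measure.pi μ = 0 := by
    rw [integral_sub' hint integrable_condExp, integral_condExp (Filtration.piFinset.le _),
      sub_self]
  have hmeas : AEStronglyMeasurable (fun x => M x - coordAverage μ {i}ᶜ M x) (Measure.pi μ) :=
    hM.1.sub (integrable_coordAverage _ hint).1
  calc ENNReal.ofReal Var[M - (Measure.pi μ)[M | Filtration.piFinset {i}ᶜ]; Measure.pi μ]
    _ = ∫⁻ x, ‖M x - coordAverage μ {i}ᶜ M x‖ₑ ^ 2 ∂Measure.pi μ := by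
        rw [ofReal_variance (hM.sub (hM.condExp one_le_two)), evariance, hmean]
        refine lintegral_congr_ae ?_
        filter_upwards [condExp_piFinset_ae_eq {i}ᶜ hint] with x hx
        rw [Pi.sub_apply, hx, sub_zero]
    _ = ∫⁻ p : (Fin n → ℝ) × ℝ,
          ‖M (i.insertNth p.2 p.1) - coordAverage μ {i}ᶜ M (i.insertNth p.2 p.1)‖ₑ ^ 2
            ∂(marginal μ i).prod (μ i) :=
        ((measurePreserving_insertNth μ i).lintegral_comp_emb
          (insertNthMeasurableEquiv i).measurableEmbedding _).symm
    _ = ∫⁻ y, ∫⁻ t, ‖M (i.insertNth t y) - coordAverage μ {i}ᶜ M (i.insertNth t y)‖ₑ ^ 2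
          ∂μ i ∂marginal μ i :=
        lintegral_prod _ ((hmeas.comp_measurePreserving
          (measurePreserving_insertNth μ i)).enorm.pow_const 2)
    _ = ∫⁻ y, evariance (fun t => M (i.insertNth t y)) (μ i) ∂marginal μ i := by
        refine lintegral_congr_ae ?_
        filter_upwards [ae_memLp_two_slice (memLp_comp_insertNth hM)] with y hy
        refine lintegral_congr fun t => ?_
        rw [coordAverage_compl_singleton (by simpa only [Fin.update_insertNth] using hy.1)]
        simp only [Fin.update_insertNth]

theorem ofReal_totalSobolIndex_le {C : ℝ} (hC : PoincareInequality a b (μ i) w C) (hC0 : 0 < C)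
    (hp : IsKufnerOpicPair (openInterval a b) (μ i) w) (hM : MemLp M 2 (Measure.pi μ))
    (hdiff : ∀ᵐ y ∂marginal μ i, ∀ t ∈ openInterval a b,
      DifferentiableAt ℝ (fun s => M (i.insertNth s y)) t)
    (hvar : 0 < Var[M; Measure.pi μ]) {N : (I : Finset (Fin (n + 1))) → (I → ℝ) → ℝ}
    (hN : IsSobolHoeffding (Measure.pi μ) M N) :
    ENNReal.ofReal (totalSobolIndex (Measure.pi μ) M N i) ≤
      ENNReal.ofReal C * dgsm μ w i M / ENNReal.ofReal Var[M; Measure.pi μ] := by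
  have hsum : M =ᵐ[Measure.pi μ] ∑ I, fun x => N I (I.restrict x) :=
    hN.sum_eq.trans (Eq.eventuallyEq (by ext; simp only [Finset.sum_apply]))
  rw [totalSobolIndex, ENNReal.ofReal_div_of_pos hvar,
    hN.isHoeffdingFamily.sum_variance_mem hsum i, ofReal_variance_sub_condExp_compl hM,
    dgsm_eq_lintegral_slice hp hM.1 hdiff, ← lintegral_const_mul' _ _ ENNReal.ofReal_ne_top]
  refine ENNReal.div_le_div_right (lintegral_mono_ae ?_) _
  filter_upwards [hdiff, ae_memLp_two_slice (memLp_comp_insertNth hM)] with y hy hy2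
  exact hC.evariance_le hC0 hp hy hy2

end TotalIndex

lemma ae_forall_differentiableAt_update {d : ℕ} {μ : Fin d → Measure ℝ}
    [∀ k, IsProbabilityMeasure (μ k)] {S : Fin d → Set ℝ} (hS : ∀ k, ∀ᵐ t ∂μ k, t ∈ S k)
    {M : (Fin d → ℝ) → ℝ} {i : Fin d}
    (hdiff : ∀ x : Fin d → ℝ, (∀ k, x k ∈ S k) →
      DifferentiableAt ℝ (fun t => M (update x i t)) (x i)) :
    ∀ᵐ x ∂Measure.pi μ, ∀ t ∈ S i, DifferentiableAt ℝ (fun s => M (update x i s)) t := by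
  filter_upwards [ae_all_iff.2 fun k =>
    (measurePreserving_eval μ k).quasiMeasurePreserving.ae (hS k)] with x hx t ht
  have hmem : ∀ k, update x i t k ∈ S k := fun k => by
    rcases eq_or_ne k i with rfl | hk
    · rwa [update_self]
    · rw [update_of_ne hk]
      exact hx k
  simpa only [update_idem, update_self] using hdiff _ hmem

lemma tsum_eq_tsum_one_le {ι : Type*} (i : ι) {lam : ℕ → ℝ} (h0 : lam 0 = 0)
    (c : (ι → ℕ) → ℝ) :
    ∑' α, ENNReal.ofReal (lam (α i) * c α) =
      ∑' α : {α : ι → ℕ // 1 ≤ α i}, ENNReal.ofReal (lam (α.1 i) * c α.1) := by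
  refine (tsum_subtype_eq_of_support_subset (s := {α : ι → ℕ | 1 ≤ α i})
    fun α hα => Nat.one_le_iff_ne_zero.2 fun h => hα ?_).symm
  simp only [h, h0, zero_mul, ENNReal.ofReal_zero]

end

theorem mainTheorem3_general {d : ℕ} (μ : Fin d → Measure ℝ) [∀ k, IsProbabilityMeasure (μ k)]
    (i : Fin d) {a b : EReal} {w : ℝ → ℝ}
    (hpair : IsKufnerOpicPair (openInterval a b) (μ i) w)
    (ψ : Fin d → ℕ → ℝ → ℝ) {lam : ℕ → ℝ} (hbasis : IsPoincareBasis a b (μ i) w (ψ i) lam)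
    (hψ : ∀ k, k ≠ i → IsParsevalFamily (μ k) (ψ k))
    {M : (Fin d → ℝ) → ℝ} (hM : MemLp M 2 (Measure.pi μ))
    (hdiff : ∀ᵐ x ∂Measure.pi μ, ∀ t ∈ openInterval a b,
      DifferentiableAt ℝ (fun s => M (Function.update x i s)) t) :
    dgsm μ w i M =
        ∑' α : {α : Fin d → ℕ // 1 ≤ α i},
          ENNReal.ofReal (lam (α.1 i) * chaosCoeff μ ψ M α.1 ^ 2) ∧
      IsPoincareConstant a b (μ i) w (1 / lam 1) ∧
      (∃ N : (I : Finset (Fin d)) → (I → ℝ) → ℝ, IsSobolHoeffding (Measure.pi μ) M N) ∧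
      (0 < variance M (Measure.pi μ) →
        ∀ N : (I : Finset (Fin d)) → (I → ℝ) → ℝ, IsSobolHoeffding (Measure.pi μ) M N →
          ENNReal.ofReal (totalSobolIndex (Measure.pi μ) M N i) ≤
            ENNReal.ofReal (1 / lam 1) * dgsm μ w i M /
              ENNReal.ofReal (variance M (Measure.pi μ))) := by
  obtain _ | n := d
  · exact i.elim0
  have hslice := ae_marginal_of_ae_update hdiff
  have hdgsm := dgsm_eq_tsum hpair hbasis hψ hM hslice
  refine ⟨hdgsm.trans (tsum_eq_tsum_one_le i hbasis.lam_zero _), hbasis.isPoincareConstant hpair,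
    exists_isSobolHoeffding hM, fun hvar N hN => ?_⟩
  exact ofReal_totalSobolIndex_le (hbasis.poincareInequality hpair)
    (one_div_pos.2 (hbasis.lam_pos one_ne_zero)) hpair hM hslice hvar hN

theorem mainTheorem3 {d : ℕ} (a b : Fin d → EReal)
    (μ : Fin d → Measure ℝ) (hμ : ∀ k, μ k ∈ densityClass (a k) (b k))
    (w : Fin d → ℝ → ℝ) (hw : ∀ k, w k ∈ weightClass (a k) (b k))
    (ψ : Fin d → ℕ → ℝ → ℝ) (lam : Fin d → ℕ → ℝ)
    (hψ : ∀ k, IsPoincareBasis (a k) (b k) (μ k) (w k) (ψ k) (lam k))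
    (M : (Fin d → ℝ) → ℝ) (hM : MemLp M 2 (Measure.pi μ)) (i : Fin d)
    (hdiff : ∀ x : Fin d → ℝ, (∀ k, x k ∈ openInterval (a k) (b k)) →
      DifferentiableAt ℝ (fun t => M (Function.update x i t)) (x i)) :
    dgsm μ (w i) i M =
        ∑' α : {α : Fin d → ℕ // 1 ≤ α i},
          ENNReal.ofReal (lam i (α.1 i) * chaosCoeff μ ψ M α.1 ^ 2) ∧
      IsPoincareConstant (a i) (b i) (μ i) (w i) (1 / lam i 1) ∧
      (∃ N : (I : Finset (Fin d)) → (I → ℝ) → ℝ, IsSobolHoeffding (Measure.pi μ) M N) ∧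
      (0 < variance M (Measure.pi μ) →
        ∀ N : (I : Finset (Fin d)) → (I → ℝ) → ℝ, IsSobolHoeffding (Measure.pi μ) M N →
          ENNReal.ofReal (totalSobolIndex (Measure.pi μ) M N i) ≤
            ENNReal.ofReal (1 / lam i 1) * dgsm μ (w i) i M /
              ENNReal.ofReal (variance M (Measure.pi μ))) := by
  have : ∀ k, IsProbabilityMeasure (μ k) := fun k => (hμ k).1
  have hpair (k) := isKufnerOpicPair_of_mem (hμ k) (hw k)
  exact mainTheorem3_general μ i (hpair i) ψ (hψ i) (fun k _ => (hψ k).isParsevalFamily) hM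
    (ae_forall_differentiableAt_update (fun k => (hpair k).ae_mem) hdiff)
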